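/- Let $|\varphi\rangle,|\psi\rangle$ be unit vectors of a finite-dimensional Hilbert space $\mathbb C^d$ (for $n$-qubit states $d=2^n$), and let $\mathrm T(\rho,\sigma)=\frac12\operatorname{tr}|\rho-\sigma|$ and $\mathrm F(\rho,\sigma)=\operatorname{tr}\sqrt{\sqrt\sigma\,\rho\sqrt\sigma}$ be the trace distance and the square root fidelity; write $\mathrm T,\mathrm F$ for their values at $\rho=|\varphi\rangle\langle\varphi|$, $\sigma=|\psi\rangle\langle\psi|$. Put $R_\psi=I-2|\psi\rangle\langle\psi|$. A *query circuit* $\mathcal A^{U_1,\dots,U_k}$ on $w$ qubits and a register $\mathbb C^d$ is a finite sequence of fixed unitaries on the whole system, queries to the oracles $U_j$ on the register, and queries to $U_j$ controlled by one of the qubits. A *$k$-samplizer* $\mathsf{Samplize}$ on $\mathbb C^d$ assigns to every $\delta\in\mathbb R$ and every query circuit $\mathcal A$ integers $S_1,\dots,S_k\ge 0$ (the numbers of samples used) and a quantum channel $\Lambda$, not depending on the states, such that, with $\mathsf{Samplize}_\delta\langle\mathcal A\rangle[|\psi_1\rangle,\dots,|\psi_k\rangle](X)=\Lambda\big(\bigotimes_j|\psi_j\rangle\langle\psi_j|^{\otimes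 S_j}\otimes X\big)$, for all $\delta>0$ and all pure states $|\psi_j\rangle\in\mathbb C^d$ $$\big\|\mathsf{Samplize}_\delta\langle\mathcal A\rangle[|\psi_1\rangle,\dots,|\psi_k\rangle]-\mathcal A^{R_{\psi_1},\dots,R_{\psi_k}}\big\|_\diamond\le\delta ,$$ where $\mathcal A^{R_{\psi_1},\dots,R_{\psi_k}}$ stands for the unitary channel of the circuit and $\|\cdot\|_\diamond$ is the diamond norm. For $\varepsilon\in(0,1)$ let $\mathcal A^{U_1,U_2}_\varepsilon=\mathsf{QPE}^{U_1U_2}_{1/10,\,\varepsilon/\pi}$ be the standard phase estimation circuit of $U_1U_2$ with $t=t(\varepsilon)=\lceil\log_2(\pi/\varepsilon)\rceil+\lceil\log_2 7\rceil$ phase qubits: Hadamard gates on the $t$ qubits; controlled powers $(U_1U_2)^{2^0},\dots,(U_1U_2)^{2^{t-1}}$, controlled by the last, …, first qubit; the inverse quantum Fourier transform on the $t$ qubits. Each controlled $U_1U_2$ is a controlled query to $U_2$ followed by one to $U_1$. **Theorem.** 1. $t(\varepsilon)=\Theta(\log(1/\varepsilon))$ as $\varepsilon\to0^+$. 2. For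 every $d$, every $2$-samplizer on $\mathbb C^d$, all pure states $|\varphi\rangle,|\psi\rangle\in\mathbb C^d$ and every $\varepsilon\in(0,1)$: measure the first $t$ qubits of $$\mathsf{Samplize}_{1/10}\langle\mathcal A_\varepsilon\rangle[|\varphi\rangle,|\psi\rangle]\big(|0\rangle\langle0|^{\otimes t}\otimes|\varphi\rangle\langle\varphi|\big)$$ in the computational basis, let $b_1,\dots,b_t$ be the outcome and $\tilde\gamma=\sum_{j=1}^t b_j2^{-j}$. With probability at least $2/3$, both $$\big||\cos(\pi\tilde\gamma-\tfrac\pi2)|-\mathrm T\big|\le\varepsilon\quad\text{and}\quad\big||\sin(\pi\tilde\gamma-\tfrac\pi2)|-\mathrm F\big|\le\varepsilon .$$ 3. There is a universal constant $C>0$ such that for every $d$ there is a $2$-samplizer on $\mathbb C^d$ for which, for every $\varepsilon\in(0,1)$, the total number of samples of $|\varphi\rangle$ and $|\psi\rangle$ used (those of $\mathsf{Samplize}_{1/10}\langle\mathcal A_\varepsilon\rangle$, plus the one copy of $|\varphi\rangle$ in the input) is at most $C/\varepsilon^2$. In particular, $\mathrm T$ and $\mathrm F$ can be estimated simultaneously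 to within additive error $\varepsilon$ with probability at least $2/3$ using $O(1/\varepsilon^2)$ samples of $|\varphi\rangle$ and $|\psi\rangle$. -/

import Mathlib

noncomputable section

namespace PureStateEstimation

open Matrix Complex
open scoped Kronecker ENNReal ComplexOrder

/-! ### Matrices, states, trace distance and fidelity -/

section States

variable {A B K : Type} [Fintype A] [DecidableEq A] [Fintype B] [DecidableEq B]
  [Fintype K] [DecidableEq K]

/-- The positive square root of a positive semidefinite matrix. -/
def matSqrt (M : Matrix A A ℂ) : Matrix A A ℂ := cfc Real.sqrt M

/-- The Schatten 1-norm `tr |M| = tr √(M† M)`. -/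
def traceNorm (M : Matrix A A ℂ) : ℝ := (matSqrt (Mᴴ * M)).trace.re

/-- The trace distance `(1/2) tr |ρ - σ|`. -/
def traceDistance (ρ σ : Matrix A A ℂ) : ℝ := traceNorm (ρ - σ) / 2

/-- The square root fidelity `tr √(√σ ρ √σ)`. -/
def fidelity (ρ σ : Matrix A A ℂ) : ℝ :=
  (matSqrt (matSqrt σ * ρ * matSqrt σ)).trace.re

/-- The rank-one operator `|ψ⟩⟨ψ|`. -/
def pureDensity (ψ : EuclideanSpace ℂ A) : Matrix A A ℂ :=
  Matrix.of fun x y => ψ x * star (ψ y)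

/-- The Householder reflection `R_ψ = I - 2|ψ⟩⟨ψ|`. -/
def reflection (ψ : EuclideanSpace ℂ A) : Matrix A A ℂ :=
  1 - (2 : ℂ) • pureDensity ψ

/-! ### Superoperators, channels and the diamond norm -/

/-- `(Φ ⊗ id_K) X`. -/
def ampliate (Φ : Matrix A A ℂ →ₗ[ℂ] Matrix B B ℂ) (X : Matrix (A × K) (A × K) ℂ) :
    Matrix (B × K) (B × K) ℂ :=
  Matrix.of fun p q => Φ (Matrix.of fun a a' => X (a, p.2) (a', q.2)) p.1 q.1

/-- Quantum channels: completely positive trace-preserving linear maps. -/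
def IsChannel (Φ : Matrix A A ℂ →ₗ[ℂ] Matrix B B ℂ) : Prop :=
  (∀ (m : ℕ) (X : Matrix (A × Fin m) (A × Fin m) ℂ), X.PosSemidef → (ampliate Φ X).PosSemidef) ∧
    ∀ X, (Φ X).trace = X.trace

/-- The diamond norm, the supremum of `‖(Φ ⊗ id) X‖_tr` over `‖X‖_tr ≤ 1`, where the identity acts
on a copy of the input system (as an extended nonnegative real, so that no boundedness is
presupposed). -/
def diamondNorm (Φ : Matrix A A ℂ →ₗ[ℂ] Matrix B B ℂ) : ℝ≥0∞ :=
  ⨆ (X : Matrix (A × A) (A × A) ℂ) (_ : traceNorm X ≤ 1), ENNReal.ofReal (traceNorm (ampliate Φ X))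

/-- The superoperator `X ↦ V X V†`. -/
def conjChannel (V : Matrix A A ℂ) : Matrix A A ℂ →ₗ[ℂ] Matrix A A ℂ where
  toFun X := V * X * Vᴴ
  map_add' X Y := by rw [mul_add, add_mul]
  map_smul' c X := by simp

end States

/-! ### Quantum query circuits -/

/-- Computational basis labels of `w` qubits; the qubit `0` is the first one. -/
abbrev Bits (w : ℕ) : Type := Fin w → Fin 2

section Circuits

variable {H : Type} [Fintype H] [DecidableEq H]

/-- The controlled operation of `U` on the oracle register, with control qubit `c`. -/
def controlled {w : ℕ} (c : Fin w) (U : Matrix H H ℂ) : Matrix (Bits w × H) (Bits w × H) ℂ :=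
  Matrix.of fun p q =>
    if p.1 = q.1 then (if p.1 c = 1 then U p.2 q.2 else (1 : Matrix H H ℂ) p.2 q.2) else 0

variable (H) in
/-- The steps of a quantum circuit on `w` qubits and a register with basis `H`, with query access
to `k` unitary operators on the register: an arbitrary unitary independent of the oracles,
a query to the `j`-th oracle, or a controlled query to the `j`-th oracle. -/
inductive QueryGate (k w : ℕ) : Type
  | unitary (G : Matrix.unitaryGroup (Bits w × H) ℂ) : QueryGate k w
  | query (j : Fin k) : QueryGate k w
  | ctrlQuery (j : Fin k) (c : Fin w) : QueryGate k w

/-- The operator performed by a step when the oracles are `U`. -/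
def QueryGate.eval {k w : ℕ} (U : Fin k → Matrix H H ℂ) :
    QueryGate H k w → Matrix (Bits w × H) (Bits w × H) ℂ
  | .unitary G => (G : Matrix (Bits w × H) (Bits w × H) ℂ)
  | .query j => (1 : Matrix (Bits w) (Bits w) ℂ) ⊗ₖ U j
  | .ctrlQuery j c => controlled c (U j)

variable (H) in
/-- A quantum query circuit: a list of steps, the head of the list being performed first. -/
abbrev QueryCircuit (k w : ℕ) : Type := List (QueryGate H k w)

/-- The operator performed by a query circuit when the oracles are `U`. -/
def evalCircuit {k w : ℕ} (U : Fin k → Matrix H H ℂ) :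
    QueryCircuit H k w → Matrix (Bits w × H) (Bits w × H) ℂ
  | [] => 1
  | g :: l => evalCircuit U l * g.eval U

/-! ### Quantum algorithms using samples, and samplizers -/

/-- The state `⊗_j |ψ_j⟩^{⊗ S_j}`. -/
def sampleState {k : ℕ} (S : Fin k → ℕ) (ψ : Fin k → EuclideanSpace ℂ H) :
    EuclideanSpace ℂ ((j : Fin k) → Fin (S j) → H) :=
  WithLp.toLp 2 fun s => ∏ j, ∏ i, ψ j (s j i)

variable (H) in
/-- A quantum algorithm on `w` qubits and a register with basis `H` that uses `samples j` copies of
an unknown state `|ψ_j⟩` for each `j`: a channel, independent of the states, that acts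
jointly on the copies and on the input system. -/
structure SampleAlgorithm (k w : ℕ) where
  samples : Fin k → ℕ
  channel : Matrix (((j : Fin k) → Fin (samples j) → H) × (Bits w × H))
      (((j : Fin k) → Fin (samples j) → H) × (Bits w × H)) ℂ →ₗ[ℂ]
    Matrix (Bits w × H) (Bits w × H) ℂ
  isChannel : IsChannel channel

/-- The channel performed on the input system when the copies are those of `ψ`. -/
def SampleAlgorithm.run {k w : ℕ} (P : SampleAlgorithm H k w) (ψ : Fin k → EuclideanSpace ℂ H) :
    Matrix (Bits w × H) (Bits w × H) ℂ →ₗ[ℂ] Matrix (Bits w × H) (Bits w × H) ℂ where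
  toFun X := P.channel (pureDensity (sampleState P.samples ψ) ⊗ₖ X)
  map_add' X Y := by rw [Matrix.kronecker_add, map_add]
  map_smul' c X := by rw [Matrix.kronecker_smul, map_smul]; rfl

variable (H) in
/-- A `k`-samplizer for pure states of the register with basis `H`: it converts query circuits to
algorithms using samples of `|ψ_1⟩, …, |ψ_k⟩` that simulate, to precision `δ` in diamond norm,
the circuit with the reflections about these states as its oracles. -/
structure Samplizer (k : ℕ) where
  conv : ℝ → (w : ℕ) → QueryCircuit H k w → SampleAlgorithm H k w
  spec : ∀ δ : ℝ, 0 < δ → ∀ (w : ℕ) (𝒜 : QueryCircuit H k w) (ψ : Fin k → EuclideanSpace ℂ H),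
    (∀ j, ‖ψ j‖ = 1) →
      diamondNorm ((conv δ w 𝒜).run ψ - conjChannel (evalCircuit (fun j => reflection (ψ j)) 𝒜))
        ≤ ENNReal.ofReal δ

end Circuits

/-! ### Phase estimation -/

/-- The integer with binary expansion `b`, the first bit being the most significant one. -/
def bitsVal {t : ℕ} (b : Bits t) : ℕ := ∑ j, (b j : ℕ) * 2 ^ (j.rev : ℕ)

/-- The Hadamard gate on each of `t` qubits. -/
def hadamardMatrix (t : ℕ) : Matrix (Bits t) (Bits t) ℂ :=
  Matrix.of fun a b => ∏ j, (if a j = 1 ∧ b j = 1 then -1 else 1) / (Real.sqrt 2 : ℂ)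

/-- The quantum Fourier transform `|j⟩ ↦ 2^{-t/2} ∑_k e^{2πi jk/2^t} |k⟩`. -/
def qftMatrix (t : ℕ) : Matrix (Bits t) (Bits t) ℂ :=
  Matrix.of fun k j =>
    Complex.exp (2 * Real.pi * Complex.I * (bitsVal j * bitsVal k : ℕ) / 2 ^ t) /
      (Real.sqrt (2 ^ t) : ℂ)

theorem hadamardMatrix_mem (t : ℕ) : hadamardMatrix t ∈ Matrix.unitaryGroup (Bits t) ℂ := by
  rw [Matrix.mem_unitaryGroup_iff]
  ext a b
  have h2 : (Real.sqrt 2 : ℂ) * (Real.sqrt 2 : ℂ) = 2 := by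
    rw [← Complex.ofReal_mul, Real.mul_self_sqrt (by norm_num)]; norm_num
  have h2' : (Real.sqrt 2 : ℂ) ≠ 0 := fun h => by simp [h] at h2
  have key : ∀ x y : Fin 2, ∑ c : Fin 2, ((if x = 1 ∧ c = 1 then -1 else 1) / (Real.sqrt 2 : ℂ)) *
      star ((if y = 1 ∧ c = 1 then -1 else 1) / (Real.sqrt 2 : ℂ)) = if x = y then 1 else 0 := by
    intro x y
    fin_cases x <;> fin_cases y <;>
      simp [Fin.sum_univ_two] <;> field_simp <;> simp [pow_two, h2]; norm_num
  simp only [Matrix.mul_apply, Matrix.star_apply, hadamardMatrix, Matrix.of_apply, star_prod,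
    ← Finset.prod_mul_distrib]
  rw [← Fintype.prod_sum (fun (j : Fin t) (c : Fin 2) =>
    ((if a j = 1 ∧ c = 1 then -1 else 1) / (Real.sqrt 2 : ℂ)) *
      star ((if b j = 1 ∧ c = 1 then -1 else 1) / (Real.sqrt 2 : ℂ)))]
  simp only [key, Matrix.one_apply]
  by_cases h : a = b
  · simp [h]
  · rw [if_neg h]
    obtain ⟨j, hj⟩ := Function.ne_iff.mp h
    exact Finset.prod_eq_zero (Finset.mem_univ j) (if_neg hj)

/-- Bit strings of length `t` correspond to the integers below `2^t`. -/
def bitsEquiv (t : ℕ) : Bits t ≃ Fin (2 ^ t) :=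
  (Equiv.arrowCongr Fin.revPerm (Equiv.refl (Fin 2))).trans finFunctionFinEquiv

theorem bitsEquiv_val {t : ℕ} (b : Bits t) : (bitsEquiv t b : ℕ) = bitsVal b := by
  simp only [bitsEquiv, Equiv.trans_apply, finFunctionFinEquiv_apply, bitsVal]
  exact Fintype.sum_equiv Fin.revPerm _ _ fun i => by simp [Equiv.arrowCongr]

theorem qftMatrix_mem (t : ℕ) : qftMatrix t ∈ Matrix.unitaryGroup (Bits t) ℂ := by
  rw [Matrix.mem_unitaryGroup_iff]
  ext a b
  have hN : (2 ^ t : ℕ) ≠ 0 := by positivity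
  have hNC : (2 ^ t : ℂ) ≠ 0 := pow_ne_zero _ two_ne_zero
  have hs : (Real.sqrt (2 ^ t) : ℂ) * (Real.sqrt (2 ^ t) : ℂ) = 2 ^ t := by
    rw [← Complex.ofReal_mul, Real.mul_self_sqrt (by positivity)]; norm_num
  set z : ℂ := Complex.exp (2 * Real.pi * Complex.I * ((bitsVal a : ℂ) - bitsVal b) / 2 ^ t) with hz
  have hterm : ∀ c : Bits t, qftMatrix t a c * star (qftMatrix t b c) =
      z ^ (bitsEquiv t c : ℕ) / 2 ^ t := by
    intro c
    rw [bitsEquiv_val, hz, ← Complex.exp_nat_mul]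
    simp only [qftMatrix, Matrix.of_apply, RCLike.star_def, map_div₀, ← Complex.exp_conj,
      Complex.conj_ofReal]
    rw [div_mul_div_comm, hs, ← Complex.exp_add]
    congr 2
    have h2 : (starRingEnd ℂ) 2 = 2 := Complex.conj_ofNat 2
    simp [h2]
    ring
  simp only [Matrix.mul_apply, Matrix.star_apply, hterm]
  rw [Equiv.sum_comp (bitsEquiv t) (fun i : Fin (2 ^ t) => z ^ (i : ℕ) / (2 ^ t : ℂ)),
    ← Finset.sum_div, Fin.sum_univ_eq_sum_range (fun i => z ^ i)]
  by_cases h : a = b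
  · subst h
    have : z = 1 := by simp [hz]
    simp [this]
  · rw [Matrix.one_apply_ne h, div_eq_zero_iff]
    left
    have hzN : z ^ (2 ^ t) = 1 := by
      rw [hz, ← Complex.exp_nat_mul, Complex.exp_eq_one_iff]
      refine ⟨(bitsVal a : ℤ) - bitsVal b, ?_⟩
      push_cast
      field_simp
    have hz1 : z ≠ 1 := by
      intro h1
      rw [hz, Complex.exp_eq_one_iff] at h1
      obtain ⟨n, hn⟩ := h1
      have h3 : ((bitsVal a : ℂ) - bitsVal b) = n * 2 ^ t := by
        have hp : (2 * Real.pi * Complex.I : ℂ) ≠ 0 := Complex.two_pi_I_ne_zero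
        rw [div_eq_iff hNC] at hn
        apply mul_left_cancel₀ hp
        rw [hn]; ring
      have h4 : ((bitsVal a : ℤ) - bitsVal b) = n * 2 ^ t := by exact_mod_cast h3
      have ha := (bitsEquiv t a).isLt
      have hb := (bitsEquiv t b).isLt
      have hne : bitsEquiv t a ≠ bitsEquiv t b := fun e => h ((bitsEquiv t).injective e)
      rw [Ne, Fin.ext_iff, bitsEquiv_val, bitsEquiv_val] at hne
      rw [bitsEquiv_val] at ha hb
      have ha' : (bitsVal a : ℤ) < 2 ^ t := by exact_mod_cast ha
      have hb' : (bitsVal b : ℤ) < 2 ^ t := by exact_mod_cast hb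
      have h5 : ((bitsVal a : ℤ) - bitsVal b) = 0 :=
        Int.eq_zero_of_abs_lt_dvd (Dvd.intro_left n h4.symm) (by rw [abs_lt]; constructor <;> omega)
      omega
    have := geom_sum_mul z (2 ^ t)
    rw [hzN, sub_self] at this
    exact (mul_eq_zero.mp this).resolve_right (sub_ne_zero.mpr hz1)

section PhaseEstimation

variable (H : Type) [Fintype H] [DecidableEq H]

/-- An operation on the `w` qubits alone, as a step of a query circuit. -/
def ancillaGate {k w : ℕ} (G : Matrix (Bits w) (Bits w) ℂ)
    (hG : G ∈ Matrix.unitaryGroup (Bits w) ℂ) : QueryGate H k w :=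
  .unitary ⟨G ⊗ₖ (1 : Matrix H H ℂ), Matrix.kronecker_mem_unitary hG (one_mem _)⟩

/-- The phase estimation circuit of `U_1 U_2` with `t` qubits for the phase: Hadamard gates; then,
for the qubits from the last to the first, controlled powers
`(U_1 U_2)^(2^0), …, (U_1 U_2)^(2^(t-1))`; then the inverse quantum Fourier transform. -/
def phaseEstimation (t : ℕ) : QueryCircuit H 2 t :=
  ancillaGate H (hadamardMatrix t) (hadamardMatrix_mem t) ::
    ((List.finRange t).reverse.flatMap fun c =>
        (List.replicate (2 ^ (c.rev : ℕ)) [QueryGate.ctrlQuery 1 c, QueryGate.ctrlQuery 0 c]).flatten) ++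
    [ancillaGate H (qftMatrix t)ᴴ (Unitary.star_mem (qftMatrix_mem t))]

/-- The number of qubits used by the standard phase estimation for failure probability `η` and
precision `δ`. -/
def phaseBits (η δ : ℝ) : ℕ := ⌈Real.logb 2 (1 / δ)⌉₊ + ⌈Real.logb 2 (2 + 1 / (2 * η))⌉₊

/-- The phase estimation circuit of `U_1 U_2` for failure probability `η` and precision `δ`. -/
def QPE (η δ : ℝ) : QueryCircuit H 2 (phaseBits η δ) := phaseEstimation H (phaseBits η δ)

end PhaseEstimation

/-! ### The estimator -/

section Estimator

variable {H : Type} [Fintype H] [DecidableEq H]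

/-- The estimate `∑_j b_j 2^{-j}` (`1 ≤ j ≤ t`) of the phase. -/
def phaseEstimate {t : ℕ} (b : Bits t) : ℝ := ∑ j : Fin t, (b j : ℕ) * (2 : ℝ)⁻¹ ^ ((j : ℕ) + 1)

/-- The probability of the outcome `b` when the `t` qubits of a system in the state `ρ` are measured
in the computational basis. -/
def outcomeProb {t : ℕ} (ρ : Matrix (Bits t × H) (Bits t × H) ℂ) (b : Bits t) : ℝ :=
  (∑ x, ρ (b, x) (b, x)).re

/-- The input state `|0⟩⟨0|^{⊗ t} ⊗ |φ⟩⟨φ|`. -/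
def inputState (t : ℕ) (φ : EuclideanSpace ℂ H) : Matrix (Bits t × H) (Bits t × H) ℂ :=
  Matrix.single (0 : Bits t) (0 : Bits t) (1 : ℂ) ⊗ₖ pureDensity φ

/-- The algorithm obtained by samplizing the phase estimation circuit to precision `1/10`. -/
def samplizedQPE (𝒮 : Samplizer H 2) (ε : ℝ) :
    SampleAlgorithm H 2 (phaseBits (1 / 10) (ε / Real.pi)) :=
  𝒮.conv (1 / 10) _ (QPE H (1 / 10) (ε / Real.pi))

/-- The state of which the first qubits are measured. -/
def finalState (𝒮 : Samplizer H 2) (ε : ℝ) (φ ψ : EuclideanSpace ℂ H) :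
    Matrix (Bits (phaseBits (1 / 10) (ε / Real.pi)) × H)
      (Bits (phaseBits (1 / 10) (ε / Real.pi)) × H) ℂ :=
  (samplizedQPE 𝒮 ε).run ![φ, ψ] (inputState _ φ)

/-- The estimate of the trace distance returned on the measurement outcome `b`. -/
def traceDistanceEstimate {t : ℕ} (b : Bits t) : ℝ :=
  |Real.cos (Real.pi * phaseEstimate b - Real.pi / 2)|

/-- The estimate of the square root fidelity returned on the measurement outcome `b`. -/
def fidelityEstimate {t : ℕ} (b : Bits t) : ℝ :=
  |Real.sin (Real.pi * phaseEstimate b - Real.pi / 2)|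

open Classical in
/-- The probability that both returned values are within `ε` of the trace distance and of the square
root fidelity of `φ` and `ψ`. -/
def successProb (𝒮 : Samplizer H 2) (ε : ℝ) (φ ψ : EuclideanSpace ℂ H) : ℝ :=
  ∑ b with |traceDistanceEstimate b - traceDistance (pureDensity φ) (pureDensity ψ)| ≤ ε ∧
      |fidelityEstimate b - fidelity (pureDensity φ) (pureDensity ψ)| ≤ ε,
    outcomeProb (finalState 𝒮 ε φ ψ) b

end Estimator

end PureStateEstimation

end

open PureStateEstimation

/-!
Three facts make up the theorem.

*Geometry.* For unit vectors `φ`, `ψ` with `|⟨φ|ψ⟩| = cos θ` the trace distance is `sin θ` and the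
fidelity is `cos θ` (`traceDistance_pureDensity`, `fidelity_pureDensity`). The product `R_φ R_ψ` of
the two reflections rotates the plane of `φ` and `ψ` by the angle `2θ`, so `φ` is a sum of two
orthogonal eigenvectors with eigenvalues `e^{±2iθ}` (`exists_eigenvectors`). Phase estimation thus
returns a number close to `θ / π` or `-θ / π` modulo `1`, and `|sin (π ·)|` and `|cos (π ·)|`, which
are even, have period `1` and are `π`-Lipschitz, turn either into the two wanted values. The outcome
`k` has amplitude a geometric sum, which is at most `1 / (2 |y|)` when `k` is at cyclic distance
`|y|` from `2^t γ`; the outcomes with `|y| > 8` therefore have total probability at most `1 / 14`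
(`sum_norm_phaseAmp_sq_le`, `idealSuccess`).

*Stability.* The diamond norm bounds the change of the probability of every event
(`norm_trace_mul_le_of_diamondNorm_le`), so the samplized circuit succeeds with probability at least
`13 / 14 - 1 / 10`, which is more than `2 / 3` (`successProb_ge`).

*A samplizer.* Given `n` copies of `ψ`, replace a query to `R_ψ` by the reflection `1 - 2 Π` about
the vectors of the `n + 1` systems (register and copies) that are invariant under cyclic shifts. The
vector `ψ^{⊗ n} ⊗ ψ` is invariant, and `ψ^{⊗ n} ⊗ x` with `x ⊥ ψ` is mapped by `Π` to a vector of
norm `1 / √(n + 1)`, since its `n + 1` shifts are orthogonal; so the replacement errs by at most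
`2 / √(n + 1)` in operator norm on inputs `ψ^{⊗ n} ⊗ x` (`norm_simProj_attach_sub_le`). The copies
are left almost untouched and serve for all queries: by a hybrid argument, `Q` queries err by at
most `2 Q / √(n + 1)` (`norm_simCircuit_sub_le`), and by twice as much in diamond norm
(`diamondNorm_stinespring_sub_le`). Hence `n ≥ 16 Q² / δ²` copies suffice, and as phase estimation
makes `Q = O(1 / ε)` queries, `O(1 / ε²)` samples are used (`samples_le`).

Matrices carry the operator norm on `ℓ²` throughout; the trace norm enters only through its duality
with the operator norm (`norm_trace_mul_le`, `exists_trace_eq_traceNorm`).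
-/

set_option linter.unusedSectionVars false

noncomputable section

namespace PureStateEstimation

open Matrix Complex
open scoped Kronecker ENNReal ComplexOrder
open scoped Matrix.Norms.L2Operator

/-! ### The operator norm -/

section OperatorNorm

variable {m n K : Type} [Fintype m] [Fintype n] [DecidableEq n]
  [Fintype K] [DecidableEq K]

theorem norm_one_matrix_le : ‖(1 : Matrix n n ℂ)‖ ≤ 1 := by
  rcases isEmpty_or_nonempty n with h | h
  · have : (1 : Matrix n n ℂ) = 0 := Subsingleton.elim _ _
    rw [this]; simp
  · exact (CStarRing.norm_one).le

theorem norm_le_of_norm_conjTranspose_mul_self_le {T : Matrix m n ℂ} {c : ℝ} (hc : 0 ≤ c)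
    (h : ‖Tᴴ * T‖ ≤ c ^ 2) : ‖T‖ ≤ c := by
  rw [l2_opNorm_conjTranspose_mul_self] at h
  nlinarith [norm_nonneg T]

theorem norm_le_one_of_isometry {T : Matrix m n ℂ} (h : Tᴴ * T = 1) : ‖T‖ ≤ 1 :=
  norm_le_of_norm_conjTranspose_mul_self_le zero_le_one (by
    rw [h, one_pow]; exact norm_one_matrix_le)

/-- Tensoring with an identity is a `*`-homomorphism of C⋆-algebras, hence contractive. -/
theorem norm_kronecker_one_le (M : Matrix n n ℂ) : ‖M ⊗ₖ (1 : Matrix K K ℂ)‖ ≤ ‖M‖ := by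
  let f : Matrix n n ℂ →⋆ₙₐ[ℂ] Matrix (n × K) (n × K) ℂ :=
    { toFun := fun M => M ⊗ₖ (1 : Matrix K K ℂ)
      map_smul' := fun c M => smul_kronecker c M 1
      map_zero' := zero_kronecker _
      map_add' := fun M N => add_kronecker M N 1
      map_mul' := fun M N => by rw [← mul_kronecker_mul, one_mul]
      map_star' := fun M => by simp [star_eq_conjTranspose, conjTranspose_kronecker] }
  exact NonUnitalStarAlgHom.norm_apply_le f M

theorem norm_one_kronecker_le (M : Matrix n n ℂ) : ‖(1 : Matrix K K ℂ) ⊗ₖ M‖ ≤ ‖M‖ := by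
  let f : Matrix n n ℂ →⋆ₙₐ[ℂ] Matrix (K × n) (K × n) ℂ :=
    { toFun := fun M => (1 : Matrix K K ℂ) ⊗ₖ M
      map_smul' := fun c M => kronecker_smul c 1 M
      map_zero' := kronecker_zero _
      map_add' := fun M N => kronecker_add 1 M N
      map_mul' := fun M N => by rw [← mul_kronecker_mul, one_mul]
      map_star' := fun M => by simp [star_eq_conjTranspose, conjTranspose_kronecker] }
  exact NonUnitalStarAlgHom.norm_apply_le f M

/-- An orthogonal projection has operator norm at most one. -/
theorem norm_le_one_of_projection {P : Matrix n n ℂ} (hP : Pᴴ = P) (hPP : P * P = P) :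
    ‖P‖ ≤ 1 := by
  have h := l2_opNorm_conjTranspose_mul_self P
  rw [hP, hPP] at h
  nlinarith [norm_nonneg P]

/-- `|tr (B† C B)| ≤ ‖C‖ tr (B† B)`, columnwise from Cauchy-Schwarz. -/
theorem norm_trace_conj_le [DecidableEq m] (C : Matrix m m ℂ) (B : Matrix m n ℂ) :
    ‖(Bᴴ * C * B).trace‖ ≤ ‖C‖ * (Bᴴ * B).trace.re := by
  have h1 : (Bᴴ * C * B).trace =
      ∑ i, inner ℂ (WithLp.toLp 2 (B.col i) : EuclideanSpace ℂ m)
        (WithLp.toLp 2 (C *ᵥ B.col i)) := by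
    rw [Matrix.trace]
    refine Finset.sum_congr rfl fun i _ => ?_
    rw [EuclideanSpace.inner_toLp_toLp, diag_apply, Matrix.mul_assoc, dotProduct_comm]
    simp only [dotProduct, mul_apply, conjTranspose_apply, mulVec, col_apply, Pi.star_apply]
  have h2 : (Bᴴ * B).trace.re = ∑ i, ‖(WithLp.toLp 2 (B.col i) : EuclideanSpace ℂ m)‖ ^ 2 := by
    rw [Matrix.trace, Complex.re_sum]
    refine Finset.sum_congr rfl fun i _ => ?_
    rw [EuclideanSpace.norm_sq_eq]
    simp only [diag_apply, mul_apply, conjTranspose_apply, Complex.re_sum, col_apply]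
    refine Finset.sum_congr rfl fun j _ => ?_
    rw [RCLike.star_def, mul_comm, Complex.mul_conj, Complex.normSq_eq_norm_sq,
      Complex.ofReal_re]
  rw [h1, h2, Finset.mul_sum]
  refine (norm_sum_le _ _).trans (Finset.sum_le_sum fun i _ => ?_)
  refine (norm_inner_le_norm _ _).trans ?_
  have := l2_opNorm_mulVec C (WithLp.toLp 2 (B.col i))
  rw [sq, mul_comm, ← mul_assoc]
  exact mul_le_mul_of_nonneg_right this (norm_nonneg _)

end OperatorNorm

/-! ### Square roots, polar decomposition and the trace norm -/

section TraceNorm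

variable {A : Type} [Fintype A] [DecidableEq A]

theorem continuousOn_spectrum (M : Matrix A A ℂ) (f : ℝ → ℝ) : ContinuousOn f (spectrum ℝ M) :=
  (Matrix.finite_real_spectrum (A := M)).continuousOn f

theorem spectrum_nonneg_of_posSemidef {M : Matrix A A ℂ} (hM : M.PosSemidef) {x : ℝ}
    (hx : x ∈ spectrum ℝ M) : 0 ≤ x :=
by
  open scoped MatrixOrder in
  exact spectrum_nonneg_of_nonneg (nonneg_iff_posSemidef.mpr hM) hx

theorem matSqrt_mul_matSqrt {M : Matrix A A ℂ} (hM : M.PosSemidef) :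
    matSqrt M * matSqrt M = M := by
  have hs : IsSelfAdjoint M := hM.1
  rw [matSqrt, ← cfc_mul _ _ M (continuousOn_spectrum M _) (continuousOn_spectrum M _)]
  conv_rhs => rw [← cfc_id' ℝ M]
  exact cfc_congr fun x hx => Real.mul_self_sqrt (spectrum_nonneg_of_posSemidef hM hx)

theorem conjTranspose_matSqrt (M : Matrix A A ℂ) : (matSqrt M)ᴴ = matSqrt M :=
  (cfc_predicate Real.sqrt M : IsSelfAdjoint _)

/-- The positive semidefinite square root is unique. -/
theorem matSqrt_eq {P M : Matrix A A ℂ} (hP : P.PosSemidef) (h : P * P = M) : matSqrt M = P := by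
  have hs : IsSelfAdjoint P := hP.1
  have h2 : cfc (fun x : ℝ => x ^ 2) P = M := by rw [cfc_pow_id P 2 hs, pow_two, h]
  rw [matSqrt, ← h2, ← cfc_comp' Real.sqrt (fun x : ℝ => x ^ 2) P
    (Real.continuous_sqrt.continuousOn) (continuousOn_spectrum P _)]
  conv_rhs => rw [← cfc_id' ℝ P]
  exact cfc_congr fun x hx => Real.sqrt_sq (spectrum_nonneg_of_posSemidef hP hx)

/-- Part of the polar decomposition: `M = V |M|` and `|M| = Vᴴ M` for a contraction `V`. -/
theorem exists_polar (M : Matrix A A ℂ) :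
    ∃ V : Matrix A A ℂ, ‖V‖ ≤ 1 ∧ V * matSqrt (Mᴴ * M) = M ∧ Vᴴ * M = matSqrt (Mᴴ * M) := by
  have hpos : (Mᴴ * M).PosSemidef := posSemidef_conjTranspose_mul_self M
  set G := Mᴴ * M with hG
  have hs : IsSelfAdjoint G := hpos.1
  -- the pseudo-inverse of `|M|`, as `(√0)⁻¹ = 0`
  set F := cfc (fun x : ℝ => (Real.sqrt x)⁻¹) G with hF
  have hFs : Fᴴ = F := (cfc_predicate (fun x : ℝ => (Real.sqrt x)⁻¹) G : IsSelfAdjoint _)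
  have hFS : F * matSqrt G = cfc (fun x : ℝ => (Real.sqrt x)⁻¹ * Real.sqrt x) G := by
    rw [hF, matSqrt, ← cfc_mul _ _ G (continuousOn_spectrum G _) (continuousOn_spectrum G _)]
  have hSF : matSqrt G * F = F * matSqrt G := (cfc_commute_cfc _ _ _).eq
  -- the projection onto the support of `|M|`
  set E := F * matSqrt G with hE
  have hEs : Eᴴ = E := by
    rw [hE, conjTranspose_mul, conjTranspose_matSqrt, hFs, hSF]
  have hEE : E * E = E := by
    rw [hFS, ← cfc_mul _ _ G (continuousOn_spectrum G _) (continuousOn_spectrum G _)]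
    refine cfc_congr fun x _ => ?_
    by_cases h : Real.sqrt x = 0
    · simp [h]
    · simp [h]
  have hSE : matSqrt G * E = matSqrt G := by
    rw [hFS, matSqrt, ← cfc_mul _ _ G (continuousOn_spectrum G _) (continuousOn_spectrum G _)]
    refine cfc_congr fun x _ => ?_
    by_cases h : Real.sqrt x = 0
    · simp [h]
    · simp [h]
  have hGE : G * E = G := by
    rw [← matSqrt_mul_matSqrt hpos, mul_assoc, hSE]
  refine ⟨M * F, ?_, ?_, ?_⟩
  · refine norm_le_of_norm_conjTranspose_mul_self_le zero_le_one ?_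
    have : (M * F)ᴴ * (M * F) = E := by
      calc (M * F)ᴴ * (M * F) = F * G * F := by
            rw [conjTranspose_mul, hFs, hG]; simp only [mul_assoc]
        _ = (F * matSqrt G) * (matSqrt G * F) := by
            conv_lhs => rw [← matSqrt_mul_matSqrt hpos]
            simp only [mul_assoc]
        _ = E := by rw [hSF, hEE]
    rw [this, one_pow]
    exact norm_le_one_of_projection hEs hEE
  · rw [mul_assoc, ← hE, ← sub_eq_zero, ← mul_sub_one]
    rw [← conjTranspose_mul_self_eq_zero]
    rw [conjTranspose_mul, mul_assoc, ← mul_assoc Mᴴ, ← hG, mul_sub_one, hGE, sub_self, mul_zero]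
  · rw [conjTranspose_mul, hFs, mul_assoc, ← hG]
    conv_lhs => rw [← matSqrt_mul_matSqrt hpos, ← mul_assoc, ← hE, ← hSF, mul_assoc, ← hE, hSE]

theorem posSemidef_matSqrt (M : Matrix A A ℂ) : (matSqrt M).PosSemidef := by
  open scoped MatrixOrder in
  exact nonneg_iff_posSemidef.mp
    (cfc_nonneg (a := M) (f := Real.sqrt) fun x _ => Real.sqrt_nonneg x)

/-- Hölder's inequality `|tr (C M)| ≤ ‖C‖ ‖M‖₁`. -/
theorem norm_trace_mul_le (C M : Matrix A A ℂ) : ‖(C * M).trace‖ ≤ ‖C‖ * traceNorm M := by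
  obtain ⟨V, hV, hVM, -⟩ := exists_polar M
  set S := matSqrt (Mᴴ * M) with hS
  have hSp : S.PosSemidef := posSemidef_matSqrt _
  have h := norm_trace_conj_le (C * V) (matSqrt S)
  rw [conjTranspose_matSqrt, matSqrt_mul_matSqrt hSp, mul_assoc, trace_mul_comm, mul_assoc,
    matSqrt_mul_matSqrt hSp, mul_assoc, hVM] at h
  have h0 : 0 ≤ S.trace.re := (Complex.le_def.mp hSp.trace_nonneg).1
  refine h.trans (mul_le_mul_of_nonneg_right ?_ h0)
  calc ‖C * V‖ ≤ ‖C‖ * ‖V‖ := norm_mul_le _ _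
    _ ≤ ‖C‖ := mul_le_of_le_one_right (norm_nonneg _) hV

/-- The trace norm is attained by a contraction. -/
theorem exists_trace_eq_traceNorm (M : Matrix A A ℂ) :
    ∃ U : Matrix A A ℂ, ‖U‖ ≤ 1 ∧ (U * M).trace.re = traceNorm M := by
  obtain ⟨V, hV, -, hVM⟩ := exists_polar M
  exact ⟨Vᴴ, by rwa [l2_opNorm_conjTranspose], by rw [hVM, traceNorm]⟩

end TraceNorm

/-! ### Stinespring operators and the diamond norm -/

section Stinespring

variable {S A B K : Type} [Fintype S] [DecidableEq S] [Fintype A] [DecidableEq A]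
  [Fintype B] [DecidableEq B] [Fintype K] [DecidableEq K]

/-- The superoperator `X ↦ tr_S (T X T†)` with Stinespring operator `T`; the system `S` is traced
out. -/
def stinespring (T : Matrix (S × B) A ℂ) : Matrix A A ℂ →ₗ[ℂ] Matrix B B ℂ where
  toFun X := ∑ s : S, (T * X * Tᴴ).submatrix (fun b => (s, b)) (fun b => (s, b))
  map_add' X Y := by
    rw [← Finset.sum_add_distrib]
    refine Finset.sum_congr rfl fun s _ => ?_
    rw [Matrix.mul_add, Matrix.add_mul]; rfl
  map_smul' c X := by
    rw [RingHom.id_apply, Finset.smul_sum]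
    refine Finset.sum_congr rfl fun s _ => ?_
    rw [Matrix.mul_smul, Matrix.smul_mul]; rfl

theorem stinespring_def (T : Matrix (S × B) A ℂ) (X : Matrix A A ℂ) : stinespring T X =
    ∑ s : S, (T * X * Tᴴ).submatrix (fun b => (s, b)) (fun b => (s, b)) := rfl

theorem stinespring_apply (T : Matrix (S × B) A ℂ) (X : Matrix A A ℂ) (b b' : B) :
    stinespring T X b b' = ∑ s, (T * X * Tᴴ) (s, b) (s, b') := by
  rw [stinespring_def, Matrix.sum_apply]; rfl

variable (K) in
/-- The operator `T ⊗ 1_K`, with the output systems ordered as `S ⊗ (B ⊗ K)`. -/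
def tensorId (T : Matrix (S × B) A ℂ) : Matrix (S × (B × K)) (A × K) ℂ :=
  Matrix.of fun p q => if p.2.2 = q.2 then T (p.1, p.2.1) q.1 else 0

theorem tensorId_sub (T T' : Matrix (S × B) A ℂ) :
    tensorId K (T - T') = tensorId K T - tensorId K T' := by
  ext p q
  simp only [tensorId, of_apply, Matrix.sub_apply]
  split_ifs <;> simp

theorem conjTranspose_tensorId_mul (T T' : Matrix (S × B) A ℂ) :
    (tensorId K T)ᴴ * tensorId K T' = (Tᴴ * T') ⊗ₖ (1 : Matrix K K ℂ) := by
  ext ⟨a, k⟩ ⟨a', k'⟩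
  simp only [mul_apply, conjTranspose_apply, tensorId, of_apply, kroneckerMap_apply,
    Fintype.sum_prod_type, one_apply]
  by_cases h : k = k'
  · subst h
    simp
  · simp [h, Ne.symm h]

theorem norm_tensorId_le (T : Matrix (S × B) A ℂ) : ‖tensorId K T‖ ≤ ‖T‖ := by
  refine norm_le_of_norm_conjTranspose_mul_self_le (norm_nonneg _) ?_
  rw [conjTranspose_tensorId_mul, sq, ← l2_opNorm_conjTranspose_mul_self T]
  exact norm_kronecker_one_le _

/-- The ampliation of a superoperator with Stinespring operator `T` has Stinespring operator
`T ⊗ 1`. -/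
theorem ampliate_stinespring (T : Matrix (S × B) A ℂ) (X : Matrix (A × K) (A × K) ℂ) :
    ampliate (stinespring T) X = stinespring (tensorId K T) X := by
  ext ⟨b, k⟩ ⟨b', k'⟩
  rw [stinespring_apply]
  simp only [ampliate, of_apply, stinespring_apply]
  refine Finset.sum_congr rfl fun s _ => ?_
  simp only [mul_apply, conjTranspose_apply, tensorId, of_apply, Fintype.sum_prod_type]
  refine Finset.sum_congr rfl fun a _ => ?_
  simp [apply_ite (starRingEnd ℂ)]

theorem posSemidef_stinespring (T : Matrix (S × B) A ℂ) {X : Matrix A A ℂ} (hX : X.PosSemidef) :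
    (stinespring T X).PosSemidef := by
  rw [stinespring_def]
  exact posSemidef_sum _ fun s _ => (hX.mul_mul_conjTranspose_same T).submatrix _

/-- The Heisenberg picture: the adjoint superoperator is `U ↦ T† (1 ⊗ U) T`. -/
theorem trace_mul_stinespring (T : Matrix (S × B) A ℂ) (U : Matrix B B ℂ) (X : Matrix A A ℂ) :
    (U * stinespring T X).trace = ((Tᴴ * ((1 : Matrix S S ℂ) ⊗ₖ U) * T) * X).trace := by
  have h : (U * stinespring T X).trace = (((1 : Matrix S S ℂ) ⊗ₖ U) * (T * X * Tᴴ)).trace := by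
    generalize hM : T * X * Tᴴ = M
    have hS : ∀ b b', stinespring T X b b' = ∑ s, M (s, b) (s, b') := fun b b' => by
      rw [stinespring_apply, hM]
    have hL : (U * stinespring T X).trace = ∑ b, ∑ b', ∑ s, U b b' * M (s, b') (s, b) := by
      simp only [Matrix.trace, diag_apply, mul_apply, hS, Finset.mul_sum]
    have hR : (((1 : Matrix S S ℂ) ⊗ₖ U) * M).trace =
        ∑ s, ∑ b, ∑ b', U b b' * M (s, b') (s, b) := by
      simp only [Matrix.trace, diag_apply, mul_apply, kroneckerMap_apply,
        Fintype.sum_prod_type, one_apply, ite_mul, one_mul, zero_mul]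
      refine Finset.sum_congr rfl fun s _ => Finset.sum_congr rfl fun b _ => ?_
      rw [Finset.sum_comm]
      refine Finset.sum_congr rfl fun b' _ => ?_
      simp
    rw [hL, hR, Finset.sum_comm]
    conv_rhs => rw [Finset.sum_comm]
    rw [Finset.sum_comm]
    exact Finset.sum_congr rfl fun b _ => Finset.sum_comm
  rw [h, ← Matrix.mul_assoc, trace_mul_comm]
  simp only [Matrix.mul_assoc]

theorem isChannel_stinespring {T : Matrix (S × B) A ℂ} (hT : Tᴴ * T = 1) :
    IsChannel (stinespring T) := by
  refine ⟨fun m X hX => ?_, fun X => ?_⟩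
  · rw [ampliate_stinespring]
    exact posSemidef_stinespring _ hX
  · have := trace_mul_stinespring T 1 X
    rwa [Matrix.one_mul, one_kronecker_one, Matrix.mul_one, hT, Matrix.one_mul] at this

theorem ampliate_sub (Φ Φ' : Matrix A A ℂ →ₗ[ℂ] Matrix B B ℂ) (X : Matrix (A × K) (A × K) ℂ) :
    ampliate (Φ - Φ') X = ampliate Φ X - ampliate Φ' X := rfl

/-- Close Stinespring operators give channels that are close in diamond norm. -/
theorem diamondNorm_stinespring_sub_le {T T' : Matrix (S × B) A ℂ} (hT : ‖T‖ ≤ 1)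
    (hT' : ‖T'‖ ≤ 1) {c : ℝ} (h : 2 * ‖T - T'‖ ≤ c) :
    diamondNorm (stinespring T - stinespring T') ≤ ENNReal.ofReal c := by
  refine iSup₂_le fun X hX => ENNReal.ofReal_le_ofReal ?_
  rw [ampliate_sub, ampliate_stinespring, ampliate_stinespring]
  obtain ⟨U, hU, hUX⟩ := exists_trace_eq_traceNorm
    (stinespring (tensorId A T) X - stinespring (tensorId A T') X)
  rw [← hUX, Matrix.mul_sub, trace_sub, trace_mul_stinespring, trace_mul_stinespring, ← trace_sub,
    ← Matrix.sub_mul]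
  have hsub : ‖tensorId A T - tensorId A T'‖ ≤ ‖T - T'‖ := by
    rw [← tensorId_sub]; exact norm_tensorId_le _
  have h1 := (norm_tensorId_le (K := A) T).trans hT
  have h1' := (norm_tensorId_le (K := A) T').trans hT'
  have hU1 : ‖(1 : Matrix S S ℂ) ⊗ₖ U‖ ≤ 1 := (norm_one_kronecker_le U).trans hU
  set R := tensorId A T
  set R' := tensorId A T'
  set V := (1 : Matrix S S ℂ) ⊗ₖ U
  -- telescoping, so that `T - T'` appears linearly
  have hdec : Rᴴ * V * R - R'ᴴ * V * R' = Rᴴ * V * (R - R') + (R - R')ᴴ * V * R' := by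
    rw [conjTranspose_sub, Matrix.mul_sub, Matrix.sub_mul, Matrix.sub_mul]; abel
  have hRV : ‖Rᴴ * V‖ ≤ 1 := by
    refine (l2_opNorm_mul _ _).trans ?_
    rw [l2_opNorm_conjTranspose]
    exact mul_le_one₀ h1 (norm_nonneg _) hU1
  have hVR : ‖V * R'‖ ≤ 1 := (l2_opNorm_mul _ _).trans (mul_le_one₀ hU1 (norm_nonneg _) h1')
  have hn : ‖Rᴴ * V * R - R'ᴴ * V * R'‖ ≤ 2 * ‖T - T'‖ := by
    rw [hdec, two_mul]
    refine (norm_add_le _ _).trans (add_le_add ?_ ?_)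
    · exact (l2_opNorm_mul _ _).trans
        ((mul_le_of_le_one_left (norm_nonneg _) hRV).trans hsub)
    · rw [Matrix.mul_assoc]
      refine (l2_opNorm_mul _ _).trans ?_
      rw [l2_opNorm_conjTranspose]
      exact (mul_le_of_le_one_right (norm_nonneg _) hVR).trans hsub
  calc _ ≤ ‖((Rᴴ * V * R - R'ᴴ * V * R') * X).trace‖ := Complex.re_le_norm _
    _ ≤ ‖Rᴴ * V * R - R'ᴴ * V * R'‖ * traceNorm X := norm_trace_mul_le _ _
    _ ≤ ‖Rᴴ * V * R - R'ᴴ * V * R'‖ := mul_le_of_le_one_right (norm_nonneg _) hX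
    _ ≤ c := hn.trans h

theorem traceNorm_pureDensity_le {v : EuclideanSpace ℂ A} (hv : ‖v‖ = 1) :
    traceNorm (pureDensity v) ≤ 1 := by
  obtain ⟨U, hU, hUv⟩ := exists_trace_eq_traceNorm (pureDensity v)
  let B : Matrix A Unit ℂ := Matrix.of fun a _ => v a
  have hB : pureDensity v = B * Bᴴ := by
    ext a a'
    simp [pureDensity, B, mul_apply]
  have hBB : (Bᴴ * B).trace.re = 1 := by
    have h2 := EuclideanSpace.norm_sq_eq v
    rw [hv, one_pow] at h2
    rw [h2, Matrix.trace, Complex.re_sum]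
    simp only [Finset.univ_unique, Finset.sum_singleton, diag_apply, mul_apply,
      conjTranspose_apply, Complex.re_sum, B, of_apply]
    refine Finset.sum_congr rfl fun j _ => ?_
    rw [RCLike.star_def, mul_comm, Complex.mul_conj, Complex.normSq_eq_norm_sq, Complex.ofReal_re]
  rw [← hUv, hB, ← Matrix.mul_assoc, trace_mul_comm, ← Matrix.mul_assoc]
  refine (Complex.re_le_norm _).trans ((norm_trace_conj_le U B).trans ?_)
  rwa [hBB, mul_one]

/-- An effect distinguishes the outputs of two superoperators on a pure state by at most the
diamond norm of their difference. -/
theorem norm_trace_mul_le_of_diamondNorm_le {Φ : Matrix A A ℂ →ₗ[ℂ] Matrix A A ℂ} {c : ℝ}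
    (hc : 0 ≤ c) (h : diamondNorm Φ ≤ ENNReal.ofReal c) {E : Matrix A A ℂ} (hE : ‖E‖ ≤ 1)
    {v : EuclideanSpace ℂ A} (hv : ‖v‖ = 1) :
    ‖(E * Φ (pureDensity v)).trace‖ ≤ c := by
  rcases isEmpty_or_nonempty A with hA | ⟨⟨e⟩⟩
  · simpa [Matrix.trace] using hc
  -- any fixed state of the reference system does
  let u : EuclideanSpace ℂ (A × A) := WithLp.toLp 2 fun p => if p.2 = e then v p.1 else 0
  have hu : ‖u‖ = 1 := by
    rw [EuclideanSpace.norm_eq] at hv ⊢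
    rw [← hv]
    congr 1
    simp [u, Fintype.sum_prod_type, apply_ite]
  have hX := traceNorm_pureDensity_le hu
  have h1 : traceNorm (ampliate Φ (pureDensity u)) ≤ c := by
    have := (le_iSup₂ (f := fun (X : Matrix (A × A) (A × A) ℂ) (_ : traceNorm X ≤ 1) =>
      ENNReal.ofReal (traceNorm (ampliate Φ X))) (pureDensity u) hX).trans h
    exact (ENNReal.ofReal_le_ofReal_iff hc).mp this
  have hamp : ∀ a k a' k', ampliate Φ (pureDensity u) (a, k) (a', k') =
      if k = e ∧ k' = e then Φ (pureDensity v) a a' else 0 := by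
    intro a k a' k'
    simp only [ampliate, of_apply]
    by_cases hk : k = e ∧ k' = e
    · rw [if_pos hk]
      have : (Matrix.of fun x x' => pureDensity u (x, k) (x', k')) = pureDensity v := by
        ext x x'
        simp [pureDensity, u, hk.1, hk.2]
      rw [this]
    · rw [if_neg hk]
      have : (Matrix.of fun x x' => pureDensity u (x, k) (x', k')) = (0 : Matrix A A ℂ) := by
        ext x x'
        rw [not_and_or] at hk
        rcases hk with hk | hk <;> simp [pureDensity, u, hk]
      rw [this, map_zero]; rfl
  have htr : ((E ⊗ₖ (1 : Matrix A A ℂ)) * ampliate Φ (pureDensity u)).trace =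
      (E * Φ (pureDensity v)).trace := by
    simp only [Matrix.trace, diag_apply, mul_apply, kroneckerMap_apply,
      Fintype.sum_prod_type, one_apply, hamp]
    refine Finset.sum_congr rfl fun a _ => ?_
    rw [Finset.sum_eq_single e]
    · refine Finset.sum_congr rfl fun a' _ => ?_
      simp
    · intro k _ hk
      simp [hk]
    · simp
  rw [← htr]
  refine (norm_trace_mul_le _ _).trans ?_
  have hE1 := (norm_kronecker_one_le (K := A) E).trans hE
  calc _ ≤ ‖E ⊗ₖ (1 : Matrix A A ℂ)‖ * c := mul_le_mul_of_nonneg_left h1 (norm_nonneg _)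
    _ ≤ c := mul_le_of_le_one_left hc hE1

end Stinespring

/-! ### Projections -/

section Projections

variable {A G Y : Type} [Fintype A] [DecidableEq A] [Fintype G] [AddCommGroup G] [Fintype Y]
  [DecidableEq Y]

theorem one_sub_two_smul_mem_unitaryGroup {P : Matrix A A ℂ} (hP : Pᴴ = P) (hPP : P * P = P) :
    1 - (2 : ℂ) • P ∈ Matrix.unitaryGroup A ℂ := by
  rw [mem_unitaryGroup_iff, star_eq_conjTranspose, conjTranspose_sub, conjTranspose_smul, hP]
  simp only [conjTranspose_one, sub_mul, mul_sub, one_mul, mul_one, smul_mul_assoc, mul_smul_comm,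
    hPP, Complex.star_def, Complex.conj_ofNat]
  module

/-- The orthogonal projection onto the functions that are supported on `p` and invariant under
the action `σ` of a finite group: the average of the permutation matrices, restricted to `p`. -/
def invariantProj (σ : G → Y → Y) (p : Y → Bool) : Matrix Y Y ℂ :=
  Matrix.of fun y y' =>
    if p y then (Fintype.card G : ℂ)⁻¹ * ∑ g, (if σ g y = y' then 1 else 0) else 0

variable {σ : G → Y → Y} {p : Y → Bool}

theorem conjTranspose_invariantProj (h0 : ∀ y, σ 0 y = y)
    (hadd : ∀ g h y, σ (g + h) y = σ g (σ h y)) (hp : ∀ g y, p (σ g y) = p y) :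
    (invariantProj σ p)ᴴ = invariantProj σ p := by
  have hinv : ∀ g y y', σ g y = y' ↔ σ (-g) y' = y := fun g y y' =>
    ⟨fun h => by rw [← h, ← hadd, neg_add_cancel, h0],
      fun h => by rw [← h, ← hadd, add_neg_cancel, h0]⟩
  have hsum : ∀ y y', (∑ g, if σ g y' = y then (1 : ℂ) else 0) = ∑ g, if σ g y = y' then 1 else 0 :=
    fun y y' => by
      rw [← Equiv.sum_comp (Equiv.neg G)]
      refine Finset.sum_congr rfl fun g _ => ?_
      rw [Equiv.neg_apply]
      exact if_congr (hinv g y y').symm rfl rfl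
  ext y y'
  simp only [conjTranspose_apply, invariantProj, of_apply]
  by_cases h : ∃ g, σ g y = y'
  · obtain ⟨g, rfl⟩ := h
    rw [hp, hsum]
    split_ifs <;> simp
  · have hz : (∑ g, if σ g y = y' then (1 : ℂ) else 0) = 0 :=
      Finset.sum_eq_zero fun g _ => if_neg fun hg => h ⟨g, hg⟩
    rw [hsum, hz]
    simp

theorem invariantProj_mul_self
    (hadd : ∀ g h y, σ (g + h) y = σ g (σ h y)) (hp : ∀ g y, p (σ g y) = p y) :
    invariantProj σ p * invariantProj σ p = invariantProj σ p := by
  ext y y'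
  simp only [mul_apply, invariantProj, of_apply]
  by_cases h : p y
  · have hc : (Fintype.card G : ℂ) ≠ 0 := Nat.cast_ne_zero.mpr Fintype.card_ne_zero
    simp only [h, if_true, Finset.mul_sum, Finset.sum_mul]
    rw [Finset.sum_comm]
    have h1 : ∀ g, (∑ z, (Fintype.card G : ℂ)⁻¹ * (if σ g y = z then 1 else 0) *
        (if p z then ∑ i, (Fintype.card G : ℂ)⁻¹ * (if σ i z = y' then 1 else 0) else 0)) =
        (Fintype.card G : ℂ)⁻¹ * ∑ i, (Fintype.card G : ℂ)⁻¹ * (if σ i y = y' then 1 else 0) := by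
      intro g
      rw [Finset.sum_eq_single (σ g y)]
      · rw [if_pos rfl, if_pos (by rw [hp, h]), mul_one]
        congr 1
        rw [← Equiv.sum_comp (Equiv.addRight g) fun i =>
          (Fintype.card G : ℂ)⁻¹ * (if σ i y = y' then 1 else 0)]
        simp [hadd]
      · intro z _ hz
        rw [if_neg (Ne.symm hz)]; simp
      · simp
    rw [Finset.sum_congr rfl fun g _ => h1 g, Finset.sum_const, Finset.card_univ, nsmul_eq_mul,
      ← mul_assoc, mul_inv_cancel₀ hc, one_mul]
  · simp [h]

theorem conjTranspose_pureDensity (ψ : EuclideanSpace ℂ A) :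
    (pureDensity ψ)ᴴ = pureDensity ψ := by
  ext x y
  simp [pureDensity, mul_comm]

theorem sum_star_mul_self {ψ : EuclideanSpace ℂ A} (h : ‖ψ‖ = 1) : ∑ x, star (ψ x) * ψ x = 1 := by
  have h2 := EuclideanSpace.norm_sq_eq ψ
  rw [h, one_pow] at h2
  rw [← Complex.ofReal_one, h2, Complex.ofReal_sum]
  refine Finset.sum_congr rfl fun x _ => ?_
  rw [RCLike.star_def, mul_comm, Complex.mul_conj, Complex.normSq_eq_norm_sq]

theorem pureDensity_mul_self {ψ : EuclideanSpace ℂ A} (h : ‖ψ‖ = 1) :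
    pureDensity ψ * pureDensity ψ = pureDensity ψ := by
  ext x y
  simp only [mul_apply, pureDensity, of_apply]
  have : ∀ z, ψ x * star (ψ z) * (ψ z * star (ψ y)) = ψ x * star (ψ y) * (star (ψ z) * ψ z) :=
    fun z => by ring
  simp only [this]
  rw [← Finset.mul_sum, sum_star_mul_self h, mul_one]

end Projections

/-! ### The shift-invariant projection and the controlled projection -/

section Simulation

variable {H : Type} [Fintype H] [DecidableEq H] {k w n : ℕ}

/-- The basis labels of the samples: `n` copies for each of the `k` states. -/
abbrev Samples (H : Type) (k n : ℕ) : Type := (_ : Fin k) → Fin n → H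

/-- The basis label of `n + 1` systems whose first one, the oracle register, is in `x` and whose
other ones are in `s`. -/
def withRegister (s : Fin n → H) (x : H) : Fin (n + 1) → H := Fin.cons x s

variable (w) in
/-- The cyclic shift by `g` of the `n + 1` systems consisting of the oracle register and the `n`
copies of the `j`-th state. -/
def cyclicShift (j : Fin k) (g : Fin (n + 1)) (y : Samples H k n × (Bits w × H)) :
    Samples H k n × (Bits w × H) :=
  (Function.update y.1 j fun i => withRegister (y.1 j) y.2.2 (i.succ + g),
    (y.2.1, withRegister (y.1 j) y.2.2 g))

theorem cyclicShift_zero (j : Fin k) (y : Samples H k n × (Bits w × H)) :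
    cyclicShift w j 0 y = y := by
  simp [cyclicShift, withRegister]

theorem cyclicShift_add (j : Fin k) (g h : Fin (n + 1)) (y : Samples H k n × (Bits w × H)) :
    cyclicShift w j (g + h) y = cyclicShift w j g (cyclicShift w j h y) := by
  have hr : withRegister (fun i : Fin n => withRegister (y.1 j) y.2.2 (i.succ + h))
      (withRegister (y.1 j) y.2.2 h) = fun i => withRegister (y.1 j) y.2.2 (i + h) := by
    funext i
    refine Fin.cases ?_ (fun i => ?_) i
    · simp [withRegister]
    · simp [withRegister]
  simp only [cyclicShift, Function.update_self, Function.update_idem, hr, add_assoc]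

variable (H w n) in
/-- The projection onto the vectors that are invariant under cyclic shifts of the register and the
copies of the `j`-th state, on the part where the control condition `q` holds. -/
def simProj (j : Fin k) (q : Bits w → Bool) :
    Matrix (Samples H k n × (Bits w × H)) (Samples H k n × (Bits w × H)) ℂ :=
  invariantProj (cyclicShift w j : Fin (n + 1) → _ → _) fun y => q y.2.1

theorem conjTranspose_simProj (j : Fin k) (q : Bits w → Bool) :
    (simProj H w n j q)ᴴ = simProj H w n j q :=
  conjTranspose_invariantProj (cyclicShift_zero j) (cyclicShift_add j) fun _ _ => rfl

theorem simProj_mul_self (j : Fin k) (q : Bits w → Bool) :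
    simProj H w n j q * simProj H w n j q = simProj H w n j q :=
  invariantProj_mul_self (cyclicShift_add j) fun _ _ => rfl

/-- The projection onto `ψ` in the register, on the part where the control condition `q` holds. -/
def ctrlProj (ψ : EuclideanSpace ℂ H) (q : Bits w → Bool) : Matrix (Bits w × H) (Bits w × H) ℂ :=
  Matrix.of fun a a' => if a.1 = a'.1 ∧ q a.1 then pureDensity ψ a.2 a'.2 else 0

variable (H) in
/-- The projection onto the part where the control condition `q` holds. -/
def condProj (q : Bits w → Bool) : Matrix (Bits w × H) (Bits w × H) ℂ :=
  Matrix.diagonal fun a => if q a.1 then 1 else 0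

theorem ctrlProj_eq (ψ : EuclideanSpace ℂ H) (q : Bits w → Bool) :
    ctrlProj ψ q = Matrix.diagonal (fun b => if q b then 1 else 0) ⊗ₖ pureDensity ψ := by
  ext ⟨b, x⟩ ⟨b', x'⟩
  simp only [ctrlProj, of_apply, kroneckerMap_apply, diagonal_apply]
  by_cases h : b = b' <;> by_cases hq : q b <;> simp [h, hq]

theorem condProj_eq (q : Bits w → Bool) :
    condProj H q = Matrix.diagonal (fun b => if q b then 1 else 0) ⊗ₖ (1 : Matrix H H ℂ) := by
  ext ⟨b, x⟩ ⟨b', x'⟩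
  simp only [condProj, kroneckerMap_apply, diagonal_apply, one_apply, Prod.mk.injEq]
  by_cases h : b = b' <;> by_cases hx : x = x' <;> simp [h, hx]

theorem conjTranspose_ctrlProj (ψ : EuclideanSpace ℂ H) (q : Bits w → Bool) :
    (ctrlProj ψ q)ᴴ = ctrlProj ψ q := by
  rw [ctrlProj_eq, conjTranspose_kronecker, conjTranspose_pureDensity, diagonal_conjTranspose]
  congr 2
  funext b
  by_cases h : q b <;> simp [h]

theorem diagonal_indicator_mul_self (q : Bits w → Bool) :
    (Matrix.diagonal (fun b => if q b then (1 : ℂ) else 0)) *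
      Matrix.diagonal (fun b => if q b then (1 : ℂ) else 0) =
      Matrix.diagonal (fun b => if q b then (1 : ℂ) else 0) := by
  rw [diagonal_mul_diagonal]
  congr 1
  funext b
  by_cases h : q b <;> simp [h]

theorem ctrlProj_mul_self {ψ : EuclideanSpace ℂ H} (h : ‖ψ‖ = 1) (q : Bits w → Bool) :
    ctrlProj ψ q * ctrlProj ψ q = ctrlProj ψ q := by
  rw [ctrlProj_eq, ← mul_kronecker_mul, pureDensity_mul_self h, diagonal_indicator_mul_self]

theorem condProj_mul_ctrlProj (ψ : EuclideanSpace ℂ H) (q : Bits w → Bool) :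
    condProj H q * ctrlProj ψ q = ctrlProj ψ q := by
  rw [ctrlProj_eq, condProj_eq, ← mul_kronecker_mul, one_mul, diagonal_indicator_mul_self]

theorem ctrlProj_mul_condProj (ψ : EuclideanSpace ℂ H) (q : Bits w → Bool) :
    ctrlProj ψ q * condProj H q = ctrlProj ψ q := by
  rw [ctrlProj_eq, condProj_eq, ← mul_kronecker_mul, mul_one, diagonal_indicator_mul_self]

theorem condProj_mul_self (q : Bits w → Bool) :
    condProj H q * condProj H q = condProj H q := by
  rw [condProj_eq, ← mul_kronecker_mul, mul_one, diagonal_indicator_mul_self]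

theorem conjTranspose_condProj (q : Bits w → Bool) : (condProj H q)ᴴ = condProj H q := by
  rw [condProj, diagonal_conjTranspose]
  congr 1
  funext b
  by_cases h : q b.1 <;> simp [h]

section Attach

variable {S A : Type} [Fintype S] [DecidableEq S] [Fintype A] [DecidableEq A]

variable (A) in
/-- The operator `x ↦ Ψ ⊗ x`. -/
def attach (Ψ : EuclideanSpace ℂ S) : Matrix (S × A) A ℂ :=
  Matrix.of fun p a => if p.2 = a then Ψ p.1 else 0

theorem attach_isometry {Ψ : EuclideanSpace ℂ S} (h : ‖Ψ‖ = 1) :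
    (attach A Ψ)ᴴ * attach A Ψ = 1 := by
  ext a a'
  simp only [mul_apply, conjTranspose_apply, attach, of_apply, Fintype.sum_prod_type, one_apply]
  by_cases haa : a = a'
  · subst haa
    have : ∀ s, (∑ x, star (if x = a then Ψ s else 0) * (if x = a then Ψ s else 0)) =
        star (Ψ s) * Ψ s := fun s => by
      rw [Finset.sum_eq_single a] <;> simp +contextual
    simp only [this, sum_star_mul_self h, if_true]
  · rw [if_neg haa]
    refine Finset.sum_eq_zero fun s _ => Finset.sum_eq_zero fun x _ => ?_
    by_cases hx : x = a
    · rw [if_neg (fun h' : x = a' => haa (hx ▸ h')), mul_zero]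
    · simp [hx]

theorem one_kronecker_mul_attach (Ψ : EuclideanSpace ℂ S) (M : Matrix A A ℂ) :
    ((1 : Matrix S S ℂ) ⊗ₖ M) * attach A Ψ = attach A Ψ * M := by
  ext ⟨s, a⟩ a'
  simp only [mul_apply, attach, of_apply, Fintype.sum_prod_type, kroneckerMap_apply, one_apply]
  rw [Finset.sum_eq_single s]
  · simp [mul_comm]
  · intro t _ ht
    simp [Ne.symm ht]
  · simp

theorem pureDensity_kronecker (Ψ : EuclideanSpace ℂ S) (X : Matrix A A ℂ) :
    pureDensity Ψ ⊗ₖ X = attach A Ψ * X * (attach A Ψ)ᴴ := by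
  ext ⟨s, a⟩ ⟨s', a'⟩
  simp only [mul_apply, attach, of_apply, kroneckerMap_apply, conjTranspose_apply, pureDensity]
  simp [apply_ite (starRingEnd ℂ)]
  ring

/-- Attaching a unit vector and tracing it out leaves conjugation by `M`. -/
theorem stinespring_attach {Ψ : EuclideanSpace ℂ S} (h : ‖Ψ‖ = 1) (M : Matrix A A ℂ) :
    stinespring (attach A Ψ * M) = conjChannel M := by
  ext X a a'
  rw [stinespring_apply, conjTranspose_mul, Matrix.mul_assoc, Matrix.mul_assoc,
    ← Matrix.mul_assoc X, ← Matrix.mul_assoc M, ← Matrix.mul_assoc (attach A Ψ),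
    ← Matrix.mul_assoc M,
    ← pureDensity_kronecker]
  simp only [kroneckerMap_apply, pureDensity, of_apply]
  rw [← Finset.sum_mul]
  simp only [mul_comm (Ψ _), sum_star_mul_self h, one_mul]
  rfl

end Attach

end Simulation

/-! ### Overlaps of shifted product vectors -/

section Overlap

variable {H : Type} [Fintype H] [DecidableEq H] {k w n : ℕ}

/-- The overlap of `ψ^{⊗ n} ⊗ e_x`, shifted by `g`, with `ψ^{⊗ n} ⊗ e_{x'}`; the register is the
system `0`. -/
theorem sum_withRegister_overlap {ψ : EuclideanSpace ℂ H} (h : ‖ψ‖ = 1) (g : Fin (n + 1))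
    (x x' : H) :
    ∑ u : Fin n → H, (∏ i, star (ψ (u i))) *
      (if withRegister u x g = x' then ∏ i : Fin n, ψ (withRegister u x (i.succ + g)) else 0) =
    if g = 0 then (if x = x' then 1 else 0) else ψ x * star (ψ x') := by
  -- `f` lists the factors of the product vector `e_{x'} ⊗ ψ ⊗ ⋯ ⊗ ψ`
  set f : Fin (n + 1) → H → ℂ := fun i y => if i = 0 then (if y = x' then 1 else 0) else ψ y
    with hf
  have h1 : ∀ u : Fin n → H, (∏ i, star (ψ (u i))) *
      (if withRegister u x g = x' then ∏ i : Fin n, ψ (withRegister u x (i.succ + g)) else 0) =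
      f (-g) x * ∏ i : Fin n, star (ψ (u i)) * f (i.succ - g) (u i) := by
    intro u
    have h2 : (if withRegister u x g = x' then ∏ i : Fin n, ψ (withRegister u x (i.succ + g))
        else 0) = ∏ i : Fin (n + 1), f i (withRegister u x (i + g)) := by
      rw [Fin.prod_univ_succ]
      simp [hf, Fin.succ_ne_zero]
    rw [h2, ← Equiv.prod_comp (Equiv.subRight g), Fin.prod_univ_succ, Finset.prod_mul_distrib]
    simp only [Equiv.subRight_apply, sub_add_cancel, zero_sub, withRegister, neg_add_cancel,
      Fin.cons_zero, Fin.cons_succ]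
    ring
  rw [Finset.sum_congr rfl fun u _ => h1 u, ← Finset.mul_sum,
    ← Fintype.prod_sum fun (i : Fin n) (y : H) => star (ψ y) * f (i.succ - g) y]
  have h3 : ∀ i : Fin n, (∑ y, star (ψ y) * f (i.succ - g) y) =
      if i.succ = g then star (ψ x') else 1 := by
    intro i
    by_cases hi : i.succ = g
    · simp [hf, hi]
    · simp only [hf, sub_eq_zero, hi, if_false]
      exact sum_star_mul_self h
  simp only [h3]
  by_cases hg : g = 0
  · subst hg
    simp [hf, Fin.succ_ne_zero]
  · obtain ⟨i, rfl⟩ := Fin.exists_succ_eq.mpr hg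
    simp only [hf, neg_eq_zero, hg, if_false, Fin.succ_inj, Finset.prod_ite_eq', Finset.mem_univ,
      if_true]

theorem norm_sampleState {k : ℕ} (S : Fin k → ℕ) {ψ : Fin k → EuclideanSpace ℂ H}
    (h : ∀ j, ‖ψ j‖ = 1) : ‖sampleState S ψ‖ = 1 := by
  have key : ∑ s, star (sampleState S ψ s) * sampleState S ψ s = 1 := by
    simp only [sampleState, star_prod, ← Finset.prod_mul_distrib]
    rw [← Fintype.prod_sum fun (j : Fin k) (u : Fin (S j) → H) =>
      ∏ i, star (ψ j (u i)) * ψ j (u i)]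
    refine Finset.prod_eq_one fun j _ => ?_
    rw [← Fintype.prod_sum fun (_ : Fin (S j)) (y : H) => star (ψ j y) * ψ j y]
    exact Finset.prod_eq_one fun i _ => sum_star_mul_self (h j)
  have h2 := EuclideanSpace.norm_sq_eq (sampleState S ψ)
  have h3 : ((‖sampleState S ψ‖ ^ 2 : ℝ) : ℂ) = 1 := by
    rw [h2, ← key, Complex.ofReal_sum]
    refine Finset.sum_congr rfl fun x _ => ?_
    rw [RCLike.star_def, mul_comm, Complex.mul_conj, Complex.normSq_eq_norm_sq]
  have h4 : ‖sampleState S ψ‖ ^ 2 = 1 := by exact_mod_cast h3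
  nlinarith [norm_nonneg (sampleState S ψ)]

/-- The overlap formula in the presence of qubits and of copies of further states. -/
theorem sum_cyclicShift_overlap {ψ : Fin k → EuclideanSpace ℂ H} (h : ∀ j, ‖ψ j‖ = 1) (j : Fin k)
    (g : Fin (n + 1)) (b b' : Bits w) (x x' : H) :
    ∑ s : Samples H k n, star (sampleState (fun _ => n) ψ s) *
      (if (cyclicShift w j g (s, (b, x))).2 = (b', x') then
        sampleState (fun _ => n) ψ (cyclicShift w j g (s, (b, x))).1 else 0) =
    if b = b' then (if g = 0 then (if x = x' then 1 else 0) else ψ j x * star (ψ j x')) else 0 := by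
  by_cases hb : b = b'
  swap
  · rw [if_neg hb]
    exact Finset.sum_eq_zero fun s _ => by simp [cyclicShift, hb]
  subst hb
  rw [if_pos rfl]
  -- the factors belonging to the copies of the `j'`-th state
  let F : Fin k → (Fin n → H) → ℂ := fun j' u =>
    (∏ i, star (ψ j' (u i))) * (if j' = j then
      (if withRegister u x g = x' then ∏ i : Fin n, ψ j' (withRegister u x (i.succ + g)) else 0)
      else ∏ i, ψ j' (u i))
  have h1 : ∀ s : Samples H k n, star (sampleState (fun _ => n) ψ s) *
      (if (cyclicShift w j g (s, (b, x))).2 = (b, x') then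
        sampleState (fun _ => n) ψ (cyclicShift w j g (s, (b, x))).1 else 0) =
      ∏ j', F j' (s j') := by
    intro s
    simp only [F, cyclicShift, sampleState, star_prod, Finset.prod_mul_distrib, Prod.mk.injEq,
      true_and]
    congr 1
    by_cases hg : withRegister (s j) x g = x'
    · rw [if_pos hg]
      refine Finset.prod_congr rfl fun j' _ => ?_
      by_cases hj : j' = j
      · subst hj
        rw [if_pos rfl, if_pos hg, Function.update_self]
      · rw [if_neg hj, Function.update_of_ne hj]
    · rw [if_neg hg]
      exact (Finset.prod_eq_zero (Finset.mem_univ j) (by rw [if_pos rfl, if_neg hg])).symm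
  rw [Finset.sum_congr rfl fun s _ => h1 s, ← Fintype.prod_sum F,
    ← Finset.mul_prod_erase Finset.univ (fun j' => ∑ u, F j' u) (Finset.mem_univ j)]
  have h3 : ∏ j' ∈ Finset.univ.erase j, ∑ u, F j' u = 1 := by
    refine Finset.prod_eq_one fun j' hj' => ?_
    have hne := Finset.ne_of_mem_erase hj'
    simp only [F, if_neg hne, ← Finset.prod_mul_distrib]
    rw [← Fintype.prod_sum fun (_ : Fin n) (y : H) => star (ψ j' y) * ψ j' y]
    exact Finset.prod_eq_one fun i _ => sum_star_mul_self (h j')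
  rw [h3, mul_one]
  simp only [F, if_true]
  exact sum_withRegister_overlap (h j) g x x'

theorem attach_conj_apply {S A : Type} [Fintype S] [Fintype A] [DecidableEq A]
    (Ψ : EuclideanSpace ℂ S) (P : Matrix (S × A) (S × A) ℂ) (a a' : A) :
    ((attach A Ψ)ᴴ * P * attach A Ψ) a a' =
      ∑ s, star (Ψ s) * ∑ s', P (s, a) (s', a') * Ψ s' := by
  rw [Matrix.mul_assoc]
  simp only [mul_apply, conjTranspose_apply, attach, of_apply, Fintype.sum_prod_type]
  refine Finset.sum_congr rfl fun s _ => ?_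
  rw [Finset.sum_eq_single a]
  · rw [if_pos rfl]
    congr 1
    refine Finset.sum_congr rfl fun s' _ => ?_
    simp
  · intro c _ hc
    rw [if_neg hc, star_zero, zero_mul]
  · simp

/-- Compressing the projection onto the shift-invariant vectors to `Ψ ⊗ ·`: only the trivial shift
leaves the register in place, and each of the other `n` shifts puts a copy of `ψ_j` into it. -/
theorem attach_simProj_attach {ψ : Fin k → EuclideanSpace ℂ H} (h : ∀ j, ‖ψ j‖ = 1) (j : Fin k)
    (q : Bits w → Bool) :
    (attach (Bits w × H) (sampleState (fun _ => n) ψ))ᴴ * simProj H w n j q *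
      attach (Bits w × H) (sampleState (fun _ => n) ψ) =
    ((n + 1 : ℕ) : ℂ)⁻¹ • (condProj H q + (n : ℂ) • ctrlProj (ψ j) q) := by
  set Ψ := sampleState (fun _ : Fin k => n) ψ with hΨ
  ext ⟨b, x⟩ ⟨b', x'⟩
  rw [attach_conj_apply]
  by_cases hq : q b
  swap
  · simp [simProj, invariantProj, hq, condProj, ctrlProj, diagonal_apply]
  have h2 : ∀ s, (∑ s', simProj H w n j q (s, (b, x)) (s', (b', x')) * Ψ s') =
      ((n + 1 : ℕ) : ℂ)⁻¹ * ∑ g : Fin (n + 1), if (cyclicShift w j g (s, (b, x))).2 = (b', x') then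
        Ψ (cyclicShift w j g (s, (b, x))).1 else 0 := by
    intro s
    simp only [simProj, invariantProj, of_apply, hq, if_true, Fintype.card_fin, mul_assoc,
      ← Finset.mul_sum, Finset.sum_mul]
    rw [Finset.sum_comm]
    congr 1
    refine Finset.sum_congr rfl fun g _ => ?_
    by_cases hg : (cyclicShift w j g (s, (b, x))).2 = (b', x')
    · rw [if_pos hg, Finset.sum_eq_single (cyclicShift w j g (s, (b, x))).1]
      · have he : cyclicShift w j g (s, (b, x)) =
            ((cyclicShift w j g (s, (b, x))).1, (b', x')) := Prod.ext rfl hg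
        rw [if_pos he, one_mul]
      · intro s' _ hs'
        rw [if_neg (fun he => hs' (by rw [he])), zero_mul]
      · simp
    · rw [if_neg hg]
      refine Finset.sum_eq_zero fun s' _ => ?_
      rw [if_neg (fun he => hg (by rw [he])), zero_mul]
  have h3 : ∑ s, star (Ψ s) * ∑ s', simProj H w n j q (s, (b, x)) (s', (b', x')) * Ψ s' =
      ((n + 1 : ℕ) : ℂ)⁻¹ * ∑ g : Fin (n + 1), if b = b' then
        (if g = 0 then (if x = x' then 1 else 0) else ψ j x * star (ψ j x')) else 0 := by
    simp only [h2, ← sum_cyclicShift_overlap h j _ b b' x x', Finset.mul_sum,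
      mul_left_comm (star _)]
    rw [Finset.sum_comm]
  rw [h3, Fin.sum_univ_succ]
  simp only [Fin.succ_ne_zero, if_true, if_false, Finset.sum_const, Finset.card_univ,
    Fintype.card_fin, nsmul_eq_mul, Matrix.smul_apply, Matrix.add_apply, smul_eq_mul, condProj,
    ctrlProj,
    of_apply, diagonal_apply, hq, pureDensity, Prod.mk.injEq, and_true]
  by_cases hb : b = b' <;> by_cases hx : x = x' <;> simp [hb, hx]

/-- On inputs that contain the copies, the shift-invariant projection is close to the projection
onto `ψ_j` in the register: the square of the difference is `(D - R) / (n + 1)` with projections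
`R ≤ D`. -/
theorem norm_simProj_attach_sub_le {ψ : Fin k → EuclideanSpace ℂ H} (h : ∀ j, ‖ψ j‖ = 1)
    (j : Fin k) (q : Bits w → Bool) :
    ‖simProj H w n j q * attach (Bits w × H) (sampleState (fun _ => n) ψ) -
      attach (Bits w × H) (sampleState (fun _ => n) ψ) * ctrlProj (ψ j) q‖ ≤
      (Real.sqrt (n + 1))⁻¹ := by
  have hV := attach_isometry (A := Bits w × H) (norm_sampleState (fun _ : Fin k => n) h)
  have hPV := attach_simProj_attach (n := n) h j q
  set V := attach (Bits w × H) (sampleState (fun _ : Fin k => n) ψ)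
  set P := simProj H w n j q
  set R := ctrlProj (ψ j) q
  set D := condProj H q
  have hP : Pᴴ = P := conjTranspose_simProj j q
  have hPP : P * P = P := simProj_mul_self j q
  have hR : Rᴴ = R := conjTranspose_ctrlProj (ψ j) q
  have hRR : R * R = R := ctrlProj_mul_self (h j) q
  have hDR : D * R = R := condProj_mul_ctrlProj (ψ j) q
  have hRD : R * D = R := ctrlProj_mul_condProj (ψ j) q
  have hDD : D * D = D := condProj_mul_self q
  have hD : Dᴴ = D := conjTranspose_condProj q
  have hn : ((n + 1 : ℕ) : ℂ) ≠ 0 := Nat.cast_ne_zero.mpr (Nat.succ_ne_zero n)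
  have hsq : (P * V - V * R)ᴴ * (P * V - V * R) = ((n + 1 : ℕ) : ℂ)⁻¹ • (D - R) := by
    have e1 : (P * V - V * R)ᴴ * (P * V - V * R) =
        Vᴴ * P * V - Vᴴ * P * V * R - R * (Vᴴ * P * V) + R * (Vᴴ * V) * R := by
      rw [conjTranspose_sub, conjTranspose_mul, conjTranspose_mul, hP, hR]
      simp only [Matrix.mul_sub, Matrix.sub_mul]
      have : Vᴴ * P * (P * V) = Vᴴ * P * V := by
        rw [Matrix.mul_assoc, ← Matrix.mul_assoc P, hPP, ← Matrix.mul_assoc]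
      rw [this]
      simp only [Matrix.mul_assoc]
      abel
    have e2 : (((n + 1 : ℕ) : ℂ)⁻¹ • (D + (n : ℂ) • R)) * R = R := by
      rw [smul_mul_assoc, add_mul, smul_mul_assoc, hDR, hRR, smul_add, smul_smul, ← add_smul]
      have : ((n + 1 : ℕ) : ℂ)⁻¹ + ((n + 1 : ℕ) : ℂ)⁻¹ * n = 1 := by
        field_simp; push_cast; ring
      rw [this, one_smul]
    have e3 : R * (((n + 1 : ℕ) : ℂ)⁻¹ • (D + (n : ℂ) • R)) = R := by
      rw [mul_smul_comm, mul_add, mul_smul_comm, hRD, hRR, smul_add, smul_smul, ← add_smul]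
      have : ((n + 1 : ℕ) : ℂ)⁻¹ + ((n + 1 : ℕ) : ℂ)⁻¹ * n = 1 := by
        field_simp; push_cast; ring
      rw [this, one_smul]
    rw [e1, hPV, e2, e3, hV, mul_one, hRR, sub_add_cancel]
    have : R = ((n + 1 : ℕ) : ℂ)⁻¹ • ((n + 1 : ℕ) : ℂ) • R := by
      rw [smul_smul, inv_mul_cancel₀ hn, one_smul]
    conv_lhs => rhs; rw [this]
    rw [← smul_sub]
    congr 1
    push_cast
    module
  have hDR1 : ‖D - R‖ ≤ 1 := by
    refine norm_le_one_of_projection (by rw [conjTranspose_sub, hD, hR]) ?_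
    rw [mul_sub, sub_mul, sub_mul, hDD, hRD, hDR, hRR, sub_self, sub_zero]
  refine norm_le_of_norm_conjTranspose_mul_self_le (by positivity) ?_
  rw [hsq, norm_smul, norm_inv, Complex.norm_natCast, inv_pow,
    Real.sq_sqrt (by positivity)]
  push_cast
  exact mul_le_of_le_one_right (by positivity) hDR1

end Overlap

/-! ### The samplizer -/

section Samplizer

variable {H : Type} [Fintype H] [DecidableEq H] {k w : ℕ}

theorem reflection_mem_unitaryGroup {ψ : EuclideanSpace ℂ H} (h : ‖ψ‖ = 1) :
    reflection ψ ∈ Matrix.unitaryGroup H ℂ :=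
  one_sub_two_smul_mem_unitaryGroup (conjTranspose_pureDensity ψ) (pureDensity_mul_self h)

/-- The number of oracle queries made by a step. -/
def QueryGate.queries : QueryGate H k w → ℕ
  | .unitary _ => 0
  | .query _ => 1
  | .ctrlQuery _ _ => 1

/-- The number of oracle queries made by a circuit. -/
def queryCount (𝒜 : QueryCircuit H k w) : ℕ := (𝒜.map QueryGate.queries).sum

theorem one_kronecker_reflection (ψ : EuclideanSpace ℂ H) :
    (1 : Matrix (Bits w) (Bits w) ℂ) ⊗ₖ reflection ψ = 1 - (2 : ℂ) • ctrlProj ψ fun _ => true := by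
  rw [ctrlProj_eq]
  simp only [if_true, diagonal_one]
  rw [← kronecker_smul, ← one_kronecker_one (m := Bits w) (n := H), reflection]
  ext ⟨b, x⟩ ⟨b', x'⟩
  simp only [kroneckerMap_apply, Matrix.sub_apply, mul_sub]

theorem controlled_reflection (c : Fin w) (ψ : EuclideanSpace ℂ H) :
    controlled c (reflection ψ) = 1 - (2 : ℂ) • ctrlProj ψ fun b => b c = 1 := by
  ext ⟨b, x⟩ ⟨b', x'⟩
  simp only [controlled, reflection, ctrlProj, of_apply, Matrix.sub_apply, Matrix.smul_apply,
    one_apply, Prod.mk.injEq, decide_eq_true_eq]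
  by_cases hb : b = b'
  · subst hb
    by_cases hc : b c = 1 <;> simp [hc]
  · simp [hb]

theorem one_kronecker_mem_unitaryGroup {S A : Type} [Fintype S] [DecidableEq S] [Fintype A]
    [DecidableEq A] {G : Matrix A A ℂ} (hG : G ∈ Matrix.unitaryGroup A ℂ) :
    (1 : Matrix S S ℂ) ⊗ₖ G ∈ Matrix.unitaryGroup (S × A) ℂ :=
  kronecker_mem_unitary (one_mem _) hG

/-- A step of the circuit with the reflections `R_{ψ_j}` as oracles is unitary. -/
theorem eval_mem_unitaryGroup {ψ : Fin k → EuclideanSpace ℂ H} (h : ∀ j, ‖ψ j‖ = 1)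
    (g : QueryGate H k w) :
    g.eval (fun j => reflection (ψ j)) ∈ Matrix.unitaryGroup (Bits w × H) ℂ := by
  cases g with
  | unitary G => exact G.2
  | query j => exact one_kronecker_mem_unitaryGroup (reflection_mem_unitaryGroup (h j))
  | ctrlQuery j c =>
    rw [QueryGate.eval, controlled_reflection]
    exact one_sub_two_smul_mem_unitaryGroup (conjTranspose_ctrlProj _ _)
      (ctrlProj_mul_self (h j) _)

theorem evalCircuit_mem_unitaryGroup {ψ : Fin k → EuclideanSpace ℂ H} (h : ∀ j, ‖ψ j‖ = 1)
    (𝒜 : QueryCircuit H k w) :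
    evalCircuit (fun j => reflection (ψ j)) 𝒜 ∈ Matrix.unitaryGroup (Bits w × H) ℂ := by
  induction 𝒜 with
  | nil => exact one_mem _
  | cons g l ih => exact mul_mem ih (eval_mem_unitaryGroup h g)

theorem norm_le_one_of_mem_unitaryGroup {A : Type} [Fintype A] [DecidableEq A] {M : Matrix A A ℂ}
    (h : M ∈ Matrix.unitaryGroup A ℂ) : ‖M‖ ≤ 1 :=
  norm_le_one_of_isometry (mem_unitaryGroup_iff'.mp h)

/-- The simulation of a step with `n` copies of each state: a query to the reflection about `ψ_j` is
replaced by the reflection about the shift-invariant vectors of the register and the copies of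
`ψ_j`. -/
def simGate (n : ℕ) : QueryGate H k w →
    Matrix (Samples H k n × (Bits w × H)) (Samples H k n × (Bits w × H)) ℂ
  | .unitary G => 1 ⊗ₖ (G : Matrix (Bits w × H) (Bits w × H) ℂ)
  | .query j => 1 - (2 : ℂ) • simProj H w n j fun _ => true
  | .ctrlQuery j c => 1 - (2 : ℂ) • simProj H w n j fun b => b c = 1

/-- The simulation of a circuit with `n` copies of each state. -/
def simCircuit (n : ℕ) : QueryCircuit H k w →
    Matrix (Samples H k n × (Bits w × H)) (Samples H k n × (Bits w × H)) ℂ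
  | [] => 1
  | g :: l => simCircuit n l * simGate n g

theorem simGate_mem_unitaryGroup (n : ℕ) (g : QueryGate H k w) :
    simGate n g ∈ Matrix.unitaryGroup (Samples H k n × (Bits w × H)) ℂ := by
  cases g with
  | unitary G => exact one_kronecker_mem_unitaryGroup G.2
  | query j =>
    exact one_sub_two_smul_mem_unitaryGroup (conjTranspose_simProj _ _) (simProj_mul_self _ _)
  | ctrlQuery j c =>
    exact one_sub_two_smul_mem_unitaryGroup (conjTranspose_simProj _ _) (simProj_mul_self _ _)

theorem simCircuit_mem_unitaryGroup (n : ℕ) (𝒜 : QueryCircuit H k w) :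
    simCircuit n 𝒜 ∈ Matrix.unitaryGroup (Samples H k n × (Bits w × H)) ℂ := by
  induction 𝒜 with
  | nil => exact one_mem _
  | cons g l ih => exact mul_mem ih (simGate_mem_unitaryGroup n g)

theorem norm_simGate_sub_le (n : ℕ) {ψ : Fin k → EuclideanSpace ℂ H} (h : ∀ j, ‖ψ j‖ = 1)
    (g : QueryGate H k w) :
    ‖simGate n g * attach (Bits w × H) (sampleState (fun _ => n) ψ) -
      attach (Bits w × H) (sampleState (fun _ => n) ψ) * g.eval fun j => reflection (ψ j)‖ ≤
      g.queries * (2 * (Real.sqrt (n + 1))⁻¹) := by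
  have key : ∀ j q, ‖(1 - (2 : ℂ) • simProj H w n j q) *
      attach (Bits w × H) (sampleState (fun _ => n) ψ) -
      attach (Bits w × H) (sampleState (fun _ => n) ψ) * (1 - (2 : ℂ) • ctrlProj (ψ j) q)‖ ≤
      2 * (Real.sqrt (n + 1))⁻¹ := by
    intro j q
    have := norm_simProj_attach_sub_le (n := n) h j q
    set V := attach (Bits w × H) (sampleState (fun _ : Fin k => n) ψ)
    have e : (1 - (2 : ℂ) • simProj H w n j q) * V - V * (1 - (2 : ℂ) • ctrlProj (ψ j) q) =
        (-2 : ℂ) • (simProj H w n j q * V - V * ctrlProj (ψ j) q) := by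
      rw [Matrix.sub_mul, Matrix.mul_sub, Matrix.one_mul, Matrix.mul_one, Matrix.smul_mul,
        Matrix.mul_smul]
      module
    rw [e, norm_smul]
    simpa using this
  cases g with
  | unitary G =>
    rw [simGate, QueryGate.eval, one_kronecker_mul_attach, sub_self]
    simp [QueryGate.queries]
  | query j =>
    rw [simGate, QueryGate.eval, one_kronecker_reflection, QueryGate.queries, Nat.cast_one, one_mul]
    exact key j _
  | ctrlQuery j c =>
    rw [simGate, QueryGate.eval, controlled_reflection, QueryGate.queries, Nat.cast_one, one_mul]
    exact key j _

/-- The hybrid argument: the errors of the simulated queries add up, and the same copies serve for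
all queries. -/
theorem norm_simCircuit_sub_le (n : ℕ) {ψ : Fin k → EuclideanSpace ℂ H} (h : ∀ j, ‖ψ j‖ = 1)
    (𝒜 : QueryCircuit H k w) :
    ‖simCircuit n 𝒜 * attach (Bits w × H) (sampleState (fun _ => n) ψ) -
      attach (Bits w × H) (sampleState (fun _ => n) ψ) *
        evalCircuit (fun j => reflection (ψ j)) 𝒜‖ ≤
      queryCount 𝒜 * (2 * (Real.sqrt (n + 1))⁻¹) := by
  induction 𝒜 with
  | nil => simp [simCircuit, evalCircuit, queryCount]
  | cons g l ih =>
    have hg := norm_simGate_sub_le n h g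
    have hW := norm_le_one_of_mem_unitaryGroup (simCircuit_mem_unitaryGroup n l)
    have hU := norm_le_one_of_mem_unitaryGroup (eval_mem_unitaryGroup h g)
    set V := attach (Bits w × H) (sampleState (fun _ : Fin k => n) ψ)
    set U := g.eval fun j => reflection (ψ j)
    have e : simCircuit n (g :: l) * V - V * evalCircuit (fun j => reflection (ψ j)) (g :: l) =
        simCircuit n l * (simGate n g * V - V * U) +
          (simCircuit n l * V - V * evalCircuit (fun j => reflection (ψ j)) l) * U := by
      rw [simCircuit, evalCircuit, Matrix.mul_sub, Matrix.sub_mul]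
      simp only [Matrix.mul_assoc]
      abel
    have hc : (queryCount (g :: l) : ℝ) = g.queries + queryCount l := by simp [queryCount]
    rw [e, hc, add_mul]
    refine (norm_add_le _ _).trans (add_le_add ?_ ?_)
    · exact (l2_opNorm_mul _ _).trans ((mul_le_of_le_one_left (norm_nonneg _) hW).trans hg)
    · exact (l2_opNorm_mul _ _).trans ((mul_le_of_le_one_right (norm_nonneg _) hU).trans ih)

/-- The number of copies of each state that suffices for simulating `Q` queries to precision `δ` in
diamond norm. -/
def copies (Q : ℕ) (δ : ℝ) : ℕ := ⌈16 * (Q : ℝ) ^ 2 / δ ^ 2⌉₊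

theorem four_mul_le_of_copies (Q : ℕ) {δ : ℝ} (hδ : 0 < δ) :
    2 * (Q * (2 * (Real.sqrt (copies Q δ + 1))⁻¹)) ≤ δ := by
  have h1 : 16 * (Q : ℝ) ^ 2 / δ ^ 2 ≤ copies Q δ := Nat.le_ceil _
  rw [div_le_iff₀ (by positivity)] at h1
  have hs : 0 < Real.sqrt (copies Q δ + 1) := Real.sqrt_pos.mpr (by positivity)
  have hsq : Real.sqrt (copies Q δ + 1) ^ 2 = copies Q δ + 1 := Real.sq_sqrt (by positivity)
  have h2 : 4 * (Q : ℝ) ≤ δ * Real.sqrt (copies Q δ + 1) := by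
    refine le_of_sq_le_sq ?_ (by positivity)
    rw [mul_pow δ, hsq]
    nlinarith [sq_nonneg δ]
  calc 2 * (Q * (2 * (Real.sqrt (copies Q δ + 1))⁻¹)) =
        4 * (Q : ℝ) / Real.sqrt (copies Q δ + 1) := by ring
    _ ≤ δ := (div_le_iff₀ hs).mpr h2

/-- The algorithm that simulates a circuit with `n` copies of each state and then discards the
copies. -/
def simAlgorithm (n : ℕ) (𝒜 : QueryCircuit H k w) : SampleAlgorithm H k w where
  samples _ := n
  channel := stinespring (S := Samples H k n) (simCircuit n 𝒜)
  isChannel := isChannel_stinespring (mem_unitaryGroup_iff'.mp (simCircuit_mem_unitaryGroup n 𝒜))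

theorem simAlgorithm_run (n : ℕ) (𝒜 : QueryCircuit H k w) (ψ : Fin k → EuclideanSpace ℂ H) :
    (simAlgorithm n 𝒜).run ψ = stinespring (S := Samples H k n)
      (simCircuit n 𝒜 * attach (Bits w × H) (sampleState (fun _ => n) ψ)) := by
  refine LinearMap.ext fun X => ?_
  change stinespring (S := Samples H k n) (simCircuit n 𝒜)
    (pureDensity (sampleState (fun _ => n) ψ) ⊗ₖ X) = _
  rw [pureDensity_kronecker, stinespring_def, stinespring_def]
  simp only [conjTranspose_mul, Matrix.mul_assoc]

variable (H k) in
/-- A samplizer that uses `O(Q² / δ²)` samples for a circuit with `Q` queries. -/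
def reflectionSamplizer : Samplizer H k where
  conv δ _ 𝒜 := simAlgorithm (copies (queryCount 𝒜) δ) 𝒜
  spec δ hδ w 𝒜 ψ h := by
    set n := copies (queryCount 𝒜) δ with hn
    have hΨ := norm_sampleState (fun _ : Fin k => n) h
    have hV := norm_le_one_of_isometry (attach_isometry (A := Bits w × H) hΨ)
    have hW := norm_le_one_of_mem_unitaryGroup (simCircuit_mem_unitaryGroup n 𝒜)
    have hU := norm_le_one_of_mem_unitaryGroup (evalCircuit_mem_unitaryGroup h 𝒜)
    rw [simAlgorithm_run, ← stinespring_attach hΨ]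
    refine diamondNorm_stinespring_sub_le ?_ ?_ ?_
    · exact (l2_opNorm_mul _ _).trans (mul_le_one₀ hW (norm_nonneg _) hV)
    · exact (l2_opNorm_mul _ _).trans (mul_le_one₀ hV (norm_nonneg _) hU)
    · refine le_trans ?_ (four_mul_le_of_copies (queryCount 𝒜) hδ)
      exact mul_le_mul_of_nonneg_left (norm_simCircuit_sub_le n h 𝒜) two_pos.le

variable (H) in
theorem queryCount_phaseEstimation (t : ℕ) : queryCount (phaseEstimation H t) ≤ 2 * 2 ^ t := by
  have hflat : ∀ L : List (List (QueryGate H 2 t)),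
      queryCount L.flatten = (L.map queryCount).sum := by
    intro L
    induction L with
    | nil => rfl
    | cons l L ih =>
      simp only [queryCount, List.flatten_cons, List.map_append, List.sum_append, List.map_cons,
        List.sum_cons] at ih ⊢
      rw [ih]
  have h1 : queryCount (phaseEstimation H t) =
      ((List.finRange t).reverse.map fun c => 2 * 2 ^ (c.rev : ℕ)).sum := by
    have : queryCount (phaseEstimation H t) = queryCount ((List.finRange t).reverse.flatMap
        fun c => (List.replicate (2 ^ (c.rev : ℕ))
          [(QueryGate.ctrlQuery 1 c : QueryGate H 2 t), QueryGate.ctrlQuery 0 c]).flatten) := by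
      simp [phaseEstimation, queryCount, ancillaGate, QueryGate.queries]
    rw [this, List.flatMap_def, hflat, List.map_map]
    congr 1
    refine List.map_congr_left fun c _ => ?_
    rw [Function.comp_apply, hflat]
    simp [queryCount, QueryGate.queries, mul_comm]
  rw [h1, List.map_reverse, List.sum_reverse, ← Fin.sum_univ_def,
    ← Equiv.sum_comp Fin.revPerm (fun c : Fin t => 2 * 2 ^ (c.rev : ℕ))]
  simp only [Fin.revPerm_apply, Fin.rev_rev]
  rw [Fin.sum_univ_eq_sum_range (fun c => 2 * 2 ^ c), ← Finset.mul_sum]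
  exact Nat.mul_le_mul_left 2 (Nat.geomSum_lt le_rfl fun c hc => Finset.mem_range.mp hc).le

end Samplizer

/-! ### Amplitudes of phase estimation -/

section PhaseAmplitude

/-- The amplitude of the outcome `k` when phase estimation with `t` qubits is applied to an
eigenvector with eigenvalue `e^{2πiγ}`. -/
def phaseAmp (t : ℕ) (γ : ℝ) (k : ℕ) : ℂ :=
  (2 ^ t)⁻¹ * ∑ m ∈ Finset.range (2 ^ t), Complex.exp (2 * Real.pi * I * (γ - k / 2 ^ t)) ^ m

/-- An outcome at distance `|y|` from the phase, in units of `2^{-t}` and modulo one, has amplitude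
at most `1 / (2 |y|)`. -/
theorem norm_phaseAmp_le (t : ℕ) (γ : ℝ) (k : ℕ) (m : ℤ) {y : ℝ}
    (hy : y = 2 ^ t * γ - k - m * 2 ^ t) (h0 : y ≠ 0) (hN : |y| ≤ 2 ^ t / 2) :
    ‖phaseAmp t γ k‖ ≤ 1 / (2 * |y|) := by
  have hNpos : (0 : ℝ) < 2 ^ t := by positivity
  set z := Complex.exp (2 * Real.pi * I * (γ - k / 2 ^ t)) with hz
  have hz' : z = Complex.exp (I * (2 * Real.pi * y / 2 ^ t : ℝ)) := by
    rw [hz, Complex.exp_eq_exp_iff_exists_int]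
    refine ⟨m, ?_⟩
    rw [hy]
    push_cast
    field_simp
    ring
  have hyabs : 0 < |y| := abs_pos.mpr h0
  have hden : 4 * |y| / 2 ^ t ≤ ‖z - 1‖ := by
    rw [hz', Complex.norm_exp_I_mul_ofReal_sub_one]
    have e : 2 * Real.pi * y / 2 ^ t / 2 = Real.pi * y / 2 ^ t := by ring
    rw [e, norm_mul, Real.norm_eq_abs, Real.norm_eq_abs, abs_two]
    have hle : |Real.pi * y / 2 ^ t| ≤ Real.pi / 2 := by
      rw [abs_div, abs_mul, abs_of_pos Real.pi_pos, abs_of_pos hNpos, div_le_iff₀ hNpos]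
      nlinarith [Real.pi_pos]
    have hj := Real.mul_abs_le_abs_sin hle
    rw [abs_div, abs_mul, abs_of_pos Real.pi_pos, abs_of_pos hNpos] at hj
    have e2 : 2 / Real.pi * (Real.pi * |y| / 2 ^ t) = 2 * |y| / 2 ^ t := by
      field_simp
    rw [e2] at hj
    calc 4 * |y| / 2 ^ t = 2 * (2 * |y| / 2 ^ t) := by ring
      _ ≤ _ := by linarith
  have hznorm : ‖z‖ = 1 := by rw [hz', mul_comm, Complex.norm_exp_ofReal_mul_I]
  have hgeom : ‖∑ i ∈ Finset.range (2 ^ t), z ^ i‖ * ‖z - 1‖ ≤ 2 := by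
    rw [← norm_mul, geom_sum_mul]
    refine (norm_sub_le _ _).trans ?_
    rw [norm_pow, hznorm, one_pow, norm_one]; norm_num
  have hamp : ‖phaseAmp t γ k‖ * 2 ^ t = ‖∑ i ∈ Finset.range (2 ^ t), z ^ i‖ := by
    rw [phaseAmp, ← hz, norm_mul, norm_inv, norm_pow, Complex.norm_ofNat]
    field_simp
  rw [le_div_iff₀ (by positivity)]
  have h3 : ‖phaseAmp t γ k‖ * 2 ^ t * (4 * |y| / 2 ^ t) ≤ 2 := by
    rw [hamp]
    exact (mul_le_mul_of_nonneg_left hden (norm_nonneg _)).trans hgeom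
  have h4 : ‖phaseAmp t γ k‖ * 2 ^ t * (4 * |y| / 2 ^ t) = 2 * (‖phaseAmp t γ k‖ * (2 * |y|)) := by
    field_simp; ring
  linarith

theorem sum_inv_sq_le (T : Finset ℕ) (hT : ∀ m ∈ T, 8 ≤ m) :
    ∑ m ∈ T, ((m : ℝ) ^ 2)⁻¹ ≤ 1 / 7 := by
  have hsub : T ⊆ Finset.Ioc 7 (T.sup id + 7) := fun m hm => by
    have h1 := hT m hm
    have h2 : m ≤ T.sup id := Finset.le_sup (f := id) hm
    rw [Finset.mem_Ioc]; omega
  refine (Finset.sum_le_sum_of_subset_of_nonneg hsub fun i _ _ => by positivity).trans ?_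
  refine (sum_Ioc_inv_sq_le_sub (by norm_num) (by omega)).trans ?_
  have : (0 : ℝ) ≤ ((T.sup id + 7 : ℕ) : ℝ)⁻¹ := by positivity
  norm_num at this ⊢
  linarith

/-- The outcomes that are far from the phase `γ` are unlikely. -/
theorem sum_norm_phaseAmp_sq_le (t : ℕ) (γ : ℝ) (B : Finset ℕ) (hB : ∀ k ∈ B, k < 2 ^ t)
    (hfar : ∀ k ∈ B, ∀ m : ℤ, 8 < |2 ^ t * γ - k - m * 2 ^ t|) :
    ∑ k ∈ B, ‖phaseAmp t γ k‖ ^ 2 ≤ 1 / 14 := by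
  have hNpos : (0 : ℝ) < 2 ^ t := by positivity
  -- the representative of `2 ^ t * γ - k` modulo `2 ^ t` of least absolute value
  let r : ℕ → ℤ := fun k => round ((2 ^ t * γ - k) / 2 ^ t)
  let y : ℕ → ℝ := fun k => 2 ^ t * γ - k - r k * 2 ^ t
  have hyN : ∀ k, |y k| ≤ 2 ^ t / 2 := by
    intro k
    have h1 := abs_sub_round ((2 ^ t * γ - k) / 2 ^ t)
    have h2 : y k = ((2 ^ t * γ - k) / 2 ^ t - r k) * 2 ^ t := by
      simp only [y]; field_simp
    rw [h2, abs_mul, abs_of_pos hNpos]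
    nlinarith
  have hy8 : ∀ k ∈ B, 8 < |y k| := fun k hk => hfar k hk (r k)
  have hinj : ∀ k ∈ B, ∀ k' ∈ B, ⌊y k⌋ = ⌊y k'⌋ → k = k' := by
    intro k hk k' hk' h
    have h1 := Int.abs_sub_lt_one_of_floor_eq_floor h
    have h2 : y k - y k' = (((k' : ℤ) - k + (r k' - r k) * 2 ^ t : ℤ) : ℝ) := by
      simp only [y]; push_cast; ring
    rw [h2, ← Int.cast_abs, ← Int.cast_one, Int.cast_lt, Int.abs_lt_one_iff] at h1
    have h3 : ((k : ℤ) - k') = 0 := by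
      refine Int.eq_zero_of_abs_lt_dvd (m := 2 ^ t) ⟨r k' - r k, by linarith⟩ ?_
      have ha : (k : ℤ) < 2 ^ t := by exact_mod_cast hB k hk
      have hb : (k' : ℤ) < 2 ^ t := by exact_mod_cast hB k' hk'
      rw [abs_lt]; constructor <;> omega
    omega
  have hbound : ∀ k ∈ B, ∀ m : ℕ, 8 ≤ m → (m : ℝ) ≤ |y k| →
      ‖phaseAmp t γ k‖ ^ 2 ≤ 1 / 4 * ((m : ℝ) ^ 2)⁻¹ := by
    intro k hk m hm hmy
    have hm' : (0 : ℝ) < m := by exact_mod_cast (by omega : 0 < m)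
    have h1 := norm_phaseAmp_le t γ k (r k) (y := y k) rfl
      (abs_pos.mp (by linarith [hy8 k hk])) (hyN k)
    have h2 : 1 / (2 * |y k|) ≤ 1 / (2 * (m : ℝ)) := by gcongr
    calc ‖phaseAmp t γ k‖ ^ 2 ≤ (1 / (2 * (m : ℝ))) ^ 2 := by
          gcongr; exact h1.trans h2
      _ = _ := by field_simp; norm_num
  -- the outcomes on either side of the phase
  have side : ∀ (B' : Finset ℕ) (f : ℕ → ℕ), B' ⊆ B → Set.InjOn f B' → (∀ k ∈ B', 8 ≤ f k) →
      (∀ k ∈ B', (f k : ℝ) ≤ |y k|) → ∑ k ∈ B', ‖phaseAmp t γ k‖ ^ 2 ≤ 1 / 28 := by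
    intro B' f hB' hf h8 hfy
    calc ∑ k ∈ B', ‖phaseAmp t γ k‖ ^ 2 ≤ ∑ k ∈ B', 1 / 4 * ((f k : ℝ) ^ 2)⁻¹ :=
          Finset.sum_le_sum fun k hk => hbound k (hB' hk) (f k) (h8 k hk) (hfy k hk)
      _ = 1 / 4 * ∑ m ∈ B'.image f, ((m : ℝ) ^ 2)⁻¹ := by
          rw [Finset.sum_image hf, Finset.mul_sum]
      _ ≤ 1 / 4 * (1 / 7) := by
          refine mul_le_mul_of_nonneg_left (sum_inv_sq_le _ fun m hm => ?_) (by norm_num)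
          obtain ⟨k, hk, rfl⟩ := Finset.mem_image.mp hm
          exact h8 k hk
      _ = 1 / 28 := by norm_num
  rw [← Finset.sum_filter_add_sum_filter_not B fun k => 0 ≤ y k]
  have hpos : ∀ k ∈ B.filter fun k => 0 ≤ y k, 8 ≤ ⌊y k⌋ := by
    intro k hk
    obtain ⟨hk, h0⟩ := Finset.mem_filter.mp hk
    have := hy8 k hk
    rw [abs_of_nonneg h0] at this
    exact Int.le_floor.mpr (by exact_mod_cast this.le)
  have hneg : ∀ k ∈ B.filter fun k => ¬ 0 ≤ y k, ⌊y k⌋ ≤ -9 := by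
    intro k hk
    obtain ⟨hk, h0⟩ := Finset.mem_filter.mp hk
    have := hy8 k hk
    rw [abs_of_neg (not_le.mp h0)] at this
    have h2 : ⌊y k⌋ < -8 := Int.floor_lt.mpr (by push_cast; linarith)
    omega
  have h1 := side (B.filter fun k => 0 ≤ y k) (fun k => ⌊y k⌋.toNat) (Finset.filter_subset _ _)
    (fun k hk k' hk' h => by
      have e1 := hpos k hk
      have e2 := hpos k' hk'
      refine hinj k (Finset.filter_subset _ _ hk) k' (Finset.filter_subset _ _ hk') ?_
      simp only at h
      omega)
    (fun k hk => by have := hpos k hk; omega)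
    (fun k hk => by
      have e1 := hpos k hk
      have e2 : ((⌊y k⌋.toNat : ℤ) : ℝ) = (⌊y k⌋ : ℝ) := by rw [Int.toNat_of_nonneg (by omega)]
      rw [Int.cast_natCast] at e2
      rw [e2]
      exact (Int.floor_le _).trans (le_abs_self _))
  have h2 := side (B.filter fun k => ¬ 0 ≤ y k) (fun k => (-⌊y k⌋ - 1).toNat)
    (Finset.filter_subset _ _)
    (fun k hk k' hk' h => by
      have e1 := hneg k hk
      have e2 := hneg k' hk'
      refine hinj k (Finset.filter_subset _ _ hk) k' (Finset.filter_subset _ _ hk') ?_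
      simp only at h
      omega)
    (fun k hk => by have := hneg k hk; omega)
    (fun k hk => by
      have e1 := hneg k hk
      have e2 : (((-⌊y k⌋ - 1).toNat : ℤ) : ℝ) = ((-⌊y k⌋ - 1 : ℤ) : ℝ) := by
        rw [Int.toNat_of_nonneg (by omega)]
      rw [Int.cast_natCast] at e2
      rw [e2]
      push_cast
      have := (Int.lt_floor_add_one (y k)).le
      refine le_trans ?_ (neg_le_abs _)
      linarith)
  linarith

end PhaseAmplitude

/-! ### The action of the phase estimation circuit -/

section CircuitAction

variable {H : Type} [Fintype H] [DecidableEq H] {k w t : ℕ}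

theorem evalCircuit_append (U : Fin k → Matrix H H ℂ) (l₁ l₂ : QueryCircuit H k w) :
    evalCircuit U (l₁ ++ l₂) = evalCircuit U l₂ * evalCircuit U l₁ := by
  induction l₁ with
  | nil => simp [evalCircuit]
  | cons g l ih => rw [List.cons_append, evalCircuit, ih, evalCircuit, mul_assoc]

/-- The operation that applies `f b` to the register when the qubits are in the basis state `b`. -/
def select (f : Bits w → Matrix H H ℂ) : Matrix (Bits w × H) (Bits w × H) ℂ :=
  Matrix.of fun p q => if p.1 = q.1 then f p.1 p.2 q.2 else 0

theorem select_mul (f g : Bits w → Matrix H H ℂ) :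
    select f * select g = select fun b => f b * g b := by
  ext ⟨b, x⟩ ⟨b', x'⟩
  simp only [mul_apply, select, of_apply, Fintype.sum_prod_type]
  rw [Finset.sum_eq_single b]
  · by_cases h : b = b' <;> simp [h]
  · intro c _ hc
    simp [Ne.symm hc]
  · simp

theorem select_one : (select fun _ => 1 : Matrix (Bits w × H) (Bits w × H) ℂ) = 1 := by
  ext ⟨b, x⟩ ⟨b', x'⟩
  simp only [select, of_apply, one_apply, Prod.mk.injEq]
  by_cases h : b = b' <;> simp [h]

theorem controlled_eq_select (c : Fin w) (U : Matrix H H ℂ) :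
    controlled c U = select fun b => if b c = 1 then U else 1 := by
  ext ⟨b, x⟩ ⟨b', x'⟩
  simp only [controlled, select, of_apply]
  by_cases h : b c = 1 <;> simp [h]

theorem evalCircuit_flatMap (U : Fin k → Matrix H H ℂ) {α : Type} (W : Matrix H H ℂ)
    (F : α → QueryCircuit H k w) (f : α → Bits w → ℕ)
    (hF : ∀ a, evalCircuit U (F a) = select fun b => W ^ f a b) (L : List α) :
    evalCircuit U (L.flatMap F) = select fun b => W ^ (L.map fun a => f a b).sum := by
  induction L with
  | nil => simp [evalCircuit, select_one]
  | cons a L ih =>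
    rw [List.flatMap_cons, evalCircuit_append, ih, hF, select_mul]
    congr 1
    funext b
    rw [← pow_add, List.map_cons, List.sum_cons, add_comm]

/-- The block of controlled queries with control qubit `c` applies the power `b_c m` of the product
of the oracles. -/
theorem evalCircuit_ctrlPower (U : Fin 2 → Matrix H H ℂ) (c : Fin w) (m : ℕ) :
    evalCircuit U (List.replicate m
      [(QueryGate.ctrlQuery 1 c : QueryGate H 2 w), QueryGate.ctrlQuery 0 c]).flatten =
      select fun b => (U 0 * U 1) ^ ((b c : ℕ) * m) := by
  have h1 : ∀ _ : Unit, evalCircuit U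
      [(QueryGate.ctrlQuery 1 c : QueryGate H 2 w), QueryGate.ctrlQuery 0 c] =
      select fun b => (U 0 * U 1) ^ (b c : ℕ) := by
    intro _
    rw [evalCircuit, evalCircuit, evalCircuit, one_mul, QueryGate.eval, QueryGate.eval,
      controlled_eq_select, controlled_eq_select, select_mul]
    congr 1
    funext b
    rcases Fin.exists_fin_two.mp ⟨b c, rfl⟩ with h | h <;> simp [h]
  have h2 := evalCircuit_flatMap U (U 0 * U 1) _ (fun _ b => (b c : ℕ)) h1 (List.replicate m ())
  rw [List.flatMap_replicate] at h2
  rw [h2]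
  congr 1
  funext b
  simp [mul_comm]

/-- The amplitudes produced by the phase estimation circuit on the input `|0⟩ ⊗ φ`. -/
theorem phaseEstimation_mulVec (U : Fin 2 → Matrix H H ℂ) (φ : H → ℂ) (b : Bits t) (x : H) :
    (evalCircuit U (phaseEstimation H t) *ᵥ fun p => if p.1 = 0 then φ p.2 else 0) (b, x) =
      (2 ^ t)⁻¹ * ∑ m ∈ Finset.range (2 ^ t),
        Complex.exp (-(2 * Real.pi * I * (m * bitsVal b) / 2 ^ t)) *
          (((U 0 * U 1) ^ m) *ᵥ φ) x := by
  have hmid := evalCircuit_flatMap U (U 0 * U 1)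
    (fun c : Fin t => (List.replicate (2 ^ (c.rev : ℕ))
      [(QueryGate.ctrlQuery 1 c : QueryGate H 2 t), QueryGate.ctrlQuery 0 c]).flatten)
    (fun c b => (b c : ℕ) * 2 ^ (c.rev : ℕ)) (fun c => evalCircuit_ctrlPower U c _)
    (List.finRange t).reverse
  have hval : ∀ b : Bits t, ((List.finRange t).reverse.map fun c =>
      (b c : ℕ) * 2 ^ (c.rev : ℕ)).sum = bitsVal b := by
    intro b
    rw [List.map_reverse, List.sum_reverse, ← Fin.sum_univ_def, bitsVal]
  simp only [hval] at hmid
  have hs : (Real.sqrt 2 : ℂ) ^ t * (Real.sqrt (2 ^ t) : ℂ) = 2 ^ t := by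
    have : Real.sqrt (2 ^ t) = Real.sqrt 2 ^ t := by
      rw [Real.sqrt_eq_iff_mul_self_eq (by positivity) (by positivity), ← mul_pow,
        Real.mul_self_sqrt (by norm_num)]
    rw [this, Complex.ofReal_pow, ← mul_pow, ← Complex.ofReal_mul,
      Real.mul_self_sqrt (by norm_num)]
    norm_num
  have hhad : (hadamardMatrix t ⊗ₖ (1 : Matrix H H ℂ)) *ᵥ
      (fun p => if p.1 = 0 then φ p.2 else 0) =
      fun p => ((Real.sqrt 2 : ℂ) ^ t)⁻¹ * φ p.2 := by
    funext ⟨c, y⟩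
    simp only [mulVec, dotProduct, Fintype.sum_prod_type, kroneckerMap_apply]
    rw [Finset.sum_eq_single 0]
    · simp [hadamardMatrix, one_apply]
    · intro d _ hd
      simp [hd]
    · simp
  rw [phaseEstimation, evalCircuit_append, evalCircuit, evalCircuit, evalCircuit, hmid,
    one_mul, ancillaGate, ancillaGate, QueryGate.eval, QueryGate.eval,
    ← mulVec_mulVec, ← mulVec_mulVec, hhad]
  have hsel : (select fun b : Bits t => (U 0 * U 1) ^ bitsVal b) *ᵥ
      (fun p : Bits t × H => ((Real.sqrt 2 : ℂ) ^ t)⁻¹ * φ p.2) =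
      fun p => ((Real.sqrt 2 : ℂ) ^ t)⁻¹ * (((U 0 * U 1) ^ bitsVal p.1) *ᵥ φ) p.2 := by
    funext ⟨c, y⟩
    simp only [mulVec, dotProduct, Fintype.sum_prod_type, select, of_apply]
    rw [Finset.sum_eq_single c]
    · rw [Finset.mul_sum]
      refine Finset.sum_congr rfl fun z _ => ?_
      rw [if_pos rfl]; ring
    · intro d _ hd
      simp [Ne.symm hd]
    · simp
  rw [hsel]
  have hq : ∀ c : Bits t, (qftMatrix t)ᴴ b c =
      Complex.exp (-(2 * Real.pi * I * ((bitsEquiv t c : ℕ) * bitsVal b) / 2 ^ t)) /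
        (Real.sqrt (2 ^ t) : ℂ) := by
    intro c
    rw [bitsEquiv_val]
    simp only [conjTranspose_apply, qftMatrix, of_apply, RCLike.star_def, map_div₀,
      ← Complex.exp_conj, Complex.conj_ofReal]
    congr 2
    have h2 : (starRingEnd ℂ) 2 = 2 := Complex.conj_ofNat 2
    simp [h2]
    ring
  have hfin : (((qftMatrix t)ᴴ ⊗ₖ (1 : Matrix H H ℂ)) *ᵥ
      fun p => ((Real.sqrt 2 : ℂ) ^ t)⁻¹ * (((U 0 * U 1) ^ bitsVal p.1) *ᵥ φ) p.2) (b, x) =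
      ∑ c : Bits t, (2 ^ t)⁻¹ *
        (Complex.exp (-(2 * Real.pi * I * ((bitsEquiv t c : ℕ) * bitsVal b) / 2 ^ t)) *
          (((U 0 * U 1) ^ (bitsEquiv t c : ℕ)) *ᵥ φ) x) := by
    simp only [mulVec, dotProduct, Fintype.sum_prod_type, kroneckerMap_apply]
    refine Finset.sum_congr rfl fun c _ => ?_
    rw [Finset.sum_eq_single x]
    · rw [one_apply_eq, hq, ← hs, bitsEquiv_val]
      field_simp
    · intro y _ hy
      simp [Ne.symm hy]
    · simp
  refine hfin.trans ?_
  rw [Equiv.sum_comp (bitsEquiv t) (fun i : Fin (2 ^ t) => (2 ^ t)⁻¹ *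
        (Complex.exp (-(2 * Real.pi * I * ((i : ℕ) * bitsVal b) / 2 ^ t)) *
          (((U 0 * U 1) ^ (i : ℕ)) *ᵥ φ) x)),
    Fin.sum_univ_eq_sum_range (fun i => (2 ^ t)⁻¹ *
        (Complex.exp (-(2 * Real.pi * I * (i * bitsVal b) / 2 ^ t)) *
          (((U 0 * U 1) ^ i) *ᵥ φ) x)), Finset.mul_sum]

theorem pow_mulVec_of_eigenvector {M : Matrix H H ℂ} {u : H → ℂ} {z : ℂ} (h : M *ᵥ u = z • u)
    (m : ℕ) : (M ^ m) *ᵥ u = z ^ m • u := by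
  induction m with
  | zero => simp
  | succ m ih => rw [pow_succ, ← mulVec_mulVec, h, mulVec_smul, ih, smul_smul, pow_succ, mul_comm]

/-- Phase estimation applied to an eigenvector. -/
theorem phaseEstimation_mulVec_eigenvector (U : Fin 2 → Matrix H H ℂ) {u : H → ℂ} {γ : ℝ}
    (h : (U 0 * U 1) *ᵥ u = Complex.exp (2 * Real.pi * I * γ) • u) (b : Bits t) (x : H) :
    (evalCircuit U (phaseEstimation H t) *ᵥ fun p => if p.1 = 0 then u p.2 else 0) (b, x) =
      phaseAmp t γ (bitsVal b) * u x := by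
  rw [phaseEstimation_mulVec, phaseAmp, mul_assoc ((2 : ℂ) ^ t)⁻¹, Finset.sum_mul]
  congr 1
  refine Finset.sum_congr rfl fun m _ => ?_
  rw [pow_mulVec_of_eigenvector h, Pi.smul_apply, smul_eq_mul, ← mul_assoc, ← Complex.exp_nat_mul,
    ← Complex.exp_add, ← Complex.exp_nat_mul]
  congr 2
  ring

end CircuitAction

/-! ### The product of two reflections -/

section Reflections

variable {H : Type} [Fintype H] [DecidableEq H]

theorem reflection_mulVec (ψ : EuclideanSpace ℂ H) (v : H → ℂ) :
    reflection ψ *ᵥ v = v - (2 * (star ψ.ofLp ⬝ᵥ v)) • ψ.ofLp := by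
  rw [reflection, sub_mulVec, one_mulVec, smul_mulVec]
  congr 1
  funext x
  simp only [Pi.smul_apply, mulVec, dotProduct, pureDensity, of_apply, smul_eq_mul, Pi.star_apply,
    Finset.mul_sum, Finset.sum_mul]
  refine Finset.sum_congr rfl fun y _ => ?_
  ring

theorem dotProduct_star_self {ψ : EuclideanSpace ℂ H} (h : ‖ψ‖ = 1) :
    star ψ.ofLp ⬝ᵥ ψ.ofLp = 1 := sum_star_mul_self h

/-- The two-dimensional rotation: `φ` is a sum of two orthogonal eigenvectors of the product of the
reflections about `φ` and `ψ`, with eigenvalues `e^{±2iθ}` where `|⟨φ|ψ⟩| = cos θ`. One of the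
eigenvectors is zero when `φ` and `ψ` are parallel or orthogonal. -/
theorem exists_eigenvectors {φ ψ : EuclideanSpace ℂ H} (hφ : ‖φ‖ = 1) (hψ : ‖ψ‖ = 1) {θ : ℝ}
    (hθ : Real.cos θ = ‖star ψ.ofLp ⬝ᵥ φ.ofLp‖) :
    ∃ u v : H → ℂ, φ.ofLp = u + v ∧
      (reflection φ * reflection ψ) *ᵥ u = Complex.exp (2 * I * θ) • u ∧
      (reflection φ * reflection ψ) *ᵥ v = Complex.exp (-(2 * I * θ)) • v ∧
      star u ⬝ᵥ v = 0 := by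
  have hφφ := dotProduct_star_self hφ
  have hψψ := dotProduct_star_self hψ
  set c := star ψ.ofLp ⬝ᵥ φ.ofLp with hc
  have hc' : star φ.ofLp ⬝ᵥ ψ.ofLp = star c := by
    rw [hc, star_dotProduct]
  set W := reflection φ * reflection ψ with hW
  have hcc : c * star c = (Real.cos θ : ℂ) ^ 2 := by
    rw [hθ, RCLike.star_def, Complex.mul_conj, Complex.normSq_eq_norm_sq]; push_cast; rfl
  have hWφ : W *ᵥ φ.ofLp = (4 * (c * star c) - 1) • φ.ofLp - (2 * c) • ψ.ofLp := by
    rw [hW, ← mulVec_mulVec, reflection_mulVec, reflection_mulVec, dotProduct_sub, dotProduct_smul,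
      hφφ, hc', ← hc]
    simp only [smul_eq_mul]
    module
  have hWψ : W *ᵥ ψ.ofLp = (2 * star c) • φ.ofLp - ψ.ofLp := by
    rw [hW, ← mulVec_mulVec, reflection_mulVec ψ, reflection_mulVec, hψψ, dotProduct_sub,
      dotProduct_smul, hc']
    simp only [smul_eq_mul]
    module
  have hWW : W *ᵥ (W *ᵥ φ.ofLp) = (4 * (c * star c) - 2) • (W *ᵥ φ.ofLp) - φ.ofLp := by
    conv_lhs => rw [hWφ, mulVec_sub, mulVec_smul, mulVec_smul, hWψ]
    rw [hWφ]
    module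
  set a := Complex.exp (2 * I * θ) with ha
  set b := Complex.exp (-(2 * I * θ)) with hb
  have hab : a * b = 1 := by rw [ha, hb, ← Complex.exp_add, add_neg_cancel, Complex.exp_zero]
  have hsum : a + b = 4 * (c * star c) - 2 := by
    have h1 : a + b = 2 * Complex.cos (2 * θ) := by
      rw [Complex.two_cos, ha, hb]; congr 2 <;> ring
    rw [h1, Complex.cos_two_mul, hcc, ← Complex.ofReal_cos]; ring
  have hconj : star a = b := by
    rw [ha, hb, RCLike.star_def, ← Complex.exp_conj]
    congr 1
    have h2 : (starRingEnd ℂ) 2 = 2 := Complex.conj_ofNat 2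
    simp [h2]
  have hiso : ∀ x y : H → ℂ, star (W *ᵥ x) ⬝ᵥ (W *ᵥ y) = star x ⬝ᵥ y := by
    intro x y
    have hWu : Wᴴ * W = 1 := mem_unitaryGroup_iff'.mp
      (mul_mem (reflection_mem_unitaryGroup hφ) (reflection_mem_unitaryGroup hψ))
    rw [star_mulVec, ← dotProduct_mulVec, mulVec_mulVec, hWu, one_mulVec]
  rw [← hsum] at hWW
  by_cases hne : a = b
  · refine ⟨φ.ofLp, 0, by simp, ?_, by simp, by simp⟩
    have h2a : 2 * a = 4 * (c * star c) - 2 := by rw [← hsum, ← hne]; ring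
    rw [← sub_eq_zero, ← dotProduct_star_self_eq_zero, star_sub, star_smul, hconj,
      ← hne]
    have haa : a * a = 1 := by rw [← hab, ← hne]
    have e2 : star φ.ofLp ⬝ᵥ (W *ᵥ φ.ofLp) = a := by
      rw [hWφ, dotProduct_sub, dotProduct_smul, dotProduct_smul, hφφ, hc']
      simp only [RCLike.star_def] at h2a ⊢
      simp
      linear_combination -h2a / 2
    have e1 : star (W *ᵥ φ.ofLp) ⬝ᵥ φ.ofLp = a := by
      rw [star_dotProduct, e2, hconj, hne]
    rw [sub_dotProduct, dotProduct_sub, dotProduct_sub, hiso, hφφ, smul_dotProduct, smul_dotProduct,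
      dotProduct_smul, dotProduct_smul, hφφ, e1, e2]
    simp only [smul_eq_mul]
    linear_combination -haa
  · have hd : a - b ≠ 0 := sub_ne_zero.mpr hne
    set u := (a - b)⁻¹ • (W *ᵥ φ.ofLp - b • φ.ofLp) with hu
    set v := (a - b)⁻¹ • (a • φ.ofLp - W *ᵥ φ.ofLp) with hv
    have hφab : φ.ofLp = (a * b) • φ.ofLp := by rw [hab, one_smul]
    have hWu : W *ᵥ u = a • u := by
      rw [hu, mulVec_smul, smul_comm a, mulVec_sub, mulVec_smul, hWW]
      congr 1
      conv_lhs => lhs; rhs; rw [hφab]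
      module
    have hWv : W *ᵥ v = b • v := by
      rw [hv, mulVec_smul, smul_comm b, mulVec_sub, mulVec_smul, hWW]
      congr 1
      conv_lhs => rhs; rhs; rw [hφab]
      module
    refine ⟨u, v, ?_, hWu, hWv, ?_⟩
    · rw [hu, hv, ← smul_add, show W *ᵥ φ.ofLp - b • φ.ofLp + (a • φ.ofLp - W *ᵥ φ.ofLp) =
        (a - b) • φ.ofLp by module, smul_smul, inv_mul_cancel₀ hd, one_smul]
    · -- unitarity makes eigenvectors with distinct eigenvalues orthogonal
      have h1 := hiso u v
      rw [hWu, hWv, star_smul, hconj, smul_dotProduct, dotProduct_smul, smul_eq_mul,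
        smul_eq_mul] at h1
      have h2 : (b - a) * (star u ⬝ᵥ v) = 0 := by
        linear_combination a * h1 - b * (star u ⬝ᵥ v) * hab
      exact (mul_eq_zero.mp h2).resolve_left (sub_ne_zero.mpr (Ne.symm hne))

end Reflections

/-! ### Fidelity and trace distance of pure states -/

section PureStates

variable {H : Type} [Fintype H] [DecidableEq H]

theorem pureDensity_eq_vecMulVec (ψ : EuclideanSpace ℂ H) :
    pureDensity ψ = vecMulVec ψ.ofLp (star ψ.ofLp) := by
  ext x y; rfl

theorem posSemidef_pureDensity (ψ : EuclideanSpace ℂ H) : (pureDensity ψ).PosSemidef := by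
  rw [pureDensity_eq_vecMulVec]
  exact posSemidef_vecMulVec_self_star _

theorem trace_pureDensity {ψ : EuclideanSpace ℂ H} (h : ‖ψ‖ = 1) : (pureDensity ψ).trace = 1 := by
  rw [← sum_star_mul_self h, Matrix.trace]
  exact Finset.sum_congr rfl fun x _ => mul_comm _ _

theorem pureDensity_mul_mul (φ ψ : EuclideanSpace ℂ H) :
    pureDensity ψ * pureDensity φ * pureDensity ψ =
      ((‖star ψ.ofLp ⬝ᵥ φ.ofLp‖ ^ 2 : ℝ) : ℂ) • pureDensity ψ := by
  have h : star φ.ofLp ⬝ᵥ ψ.ofLp = star (star ψ.ofLp ⬝ᵥ φ.ofLp) := star_dotProduct _ _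
  simp only [pureDensity_eq_vecMulVec, vecMulVec_mul_vecMulVec, smul_mul_assoc, h,
    vecMulVec_smul, smul_smul]
  rw [← Complex.normSq_eq_norm_sq, ← Complex.mul_conj, RCLike.star_def]

theorem trace_pureDensity_mul (φ ψ : EuclideanSpace ℂ H) :
    (pureDensity ψ * pureDensity φ).trace = ((‖star ψ.ofLp ⬝ᵥ φ.ofLp‖ ^ 2 : ℝ) : ℂ) := by
  have h : star φ.ofLp ⬝ᵥ ψ.ofLp = star (star ψ.ofLp ⬝ᵥ φ.ofLp) := star_dotProduct _ _
  rw [pureDensity_eq_vecMulVec, pureDensity_eq_vecMulVec, vecMulVec_mul_vecMulVec,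
    ← Complex.normSq_eq_norm_sq, ← Complex.mul_conj, ← RCLike.star_def, ← h]
  simp [trace_vecMulVec, dotProduct_comm]

theorem fidelity_pureDensity {φ ψ : EuclideanSpace ℂ H} (hψ : ‖ψ‖ = 1) :
    fidelity (pureDensity φ) (pureDensity ψ) = ‖star ψ.ofLp ⬝ᵥ φ.ofLp‖ := by
  have h1 : matSqrt (pureDensity ψ) = pureDensity ψ :=
    matSqrt_eq (posSemidef_pureDensity ψ) (pureDensity_mul_self hψ)
  have h2 : matSqrt (((‖star ψ.ofLp ⬝ᵥ φ.ofLp‖ ^ 2 : ℝ) : ℂ) • pureDensity ψ) =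
      ((‖star ψ.ofLp ⬝ᵥ φ.ofLp‖ : ℝ) : ℂ) • pureDensity ψ := by
    refine matSqrt_eq ((posSemidef_pureDensity ψ).smul ?_) ?_
    · exact_mod_cast norm_nonneg _
    · rw [smul_mul_smul_comm, pureDensity_mul_self hψ]
      push_cast
      rw [sq]
  rw [fidelity, h1, pureDensity_mul_mul, h2, trace_smul, trace_pureDensity hψ, smul_eq_mul, mul_one,
    Complex.ofReal_re]

theorem traceDistance_pureDensity {φ ψ : EuclideanSpace ℂ H} (hφ : ‖φ‖ = 1) (hψ : ‖ψ‖ = 1) :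
    traceDistance (pureDensity φ) (pureDensity ψ) =
      Real.sqrt (1 - ‖star ψ.ofLp ⬝ᵥ φ.ofLp‖ ^ 2) := by
  have hρ := pureDensity_mul_self hφ
  have hσ := pureDensity_mul_self hψ
  have hσρσ := pureDensity_mul_mul φ ψ
  have hρσρ := pureDensity_mul_mul ψ φ
  have hsymm : ‖star φ.ofLp ⬝ᵥ ψ.ofLp‖ = ‖star ψ.ofLp ⬝ᵥ φ.ofLp‖ := by
    rw [star_dotProduct, norm_star]
  rw [hsymm] at hρσρ
  have htr := trace_pureDensity_mul φ ψ
  have htr' := trace_pureDensity_mul ψ φ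
  rw [hsymm] at htr'
  set f := ‖star ψ.ofLp ⬝ᵥ φ.ofLp‖ ^ 2 with hf
  set D := pureDensity φ - pureDensity ψ with hD
  have hDs : Dᴴ = D := by
    rw [hD, conjTranspose_sub, conjTranspose_pureDensity, conjTranspose_pureDensity]
  have hD2 : D * D = pureDensity φ + pureDensity ψ - pureDensity φ * pureDensity ψ -
      pureDensity ψ * pureDensity φ := by
    rw [hD, sub_mul, mul_sub, mul_sub, hρ, hσ]; abel
  -- the spectrum of `D` is `{0, √(1 - f), -√(1 - f)}`
  have hD3 : D * D * D = ((1 - f : ℝ) : ℂ) • D := by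
    have h1 : pureDensity φ * pureDensity ψ * pureDensity ψ = pureDensity φ * pureDensity ψ := by
      rw [mul_assoc, hσ]
    have h2 : pureDensity ψ * pureDensity φ * pureDensity φ = pureDensity ψ * pureDensity φ := by
      rw [mul_assoc, hρ]
    rw [hD2, hD]
    simp only [mul_sub, sub_mul, add_mul, hρ, hσ, hρσρ, hσρσ, h1, h2]
    push_cast
    module
  have htrD : (D * D).trace = ((2 * (1 - f) : ℝ) : ℂ) := by
    rw [hD2, trace_sub, trace_sub, trace_add, trace_pureDensity hφ, trace_pureDensity hψ, htr, htr']
    push_cast; ring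
  have hpos : (D * D).PosSemidef := by
    have := posSemidef_conjTranspose_mul_self D
    rwa [hDs] at this
  have hf1 : 0 ≤ 1 - f := by
    have := hpos.trace_nonneg
    rw [htrD] at this
    have h2 : (0 : ℝ) ≤ 2 * (1 - f) := by exact_mod_cast this
    linarith
  set s := Real.sqrt (1 - f) with hs
  have hss : s * s = 1 - f := Real.mul_self_sqrt hf1
  have hsq : matSqrt (Dᴴ * D) = ((s⁻¹ : ℝ) : ℂ) • (D * D) := by
    rw [hDs]
    refine matSqrt_eq (hpos.smul ?_) ?_
    · exact_mod_cast inv_nonneg.mpr (Real.sqrt_nonneg _)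
    · -- `s⁻¹ = 0` when `s = 0`, and then `D = 0`
      by_cases h0 : s = 0
      · have : D = 0 := by
          rw [← trace_conjTranspose_mul_self_eq_zero_iff, hDs, htrD, ← hss, h0]; simp
        simp [this]
      · rw [smul_mul_smul_comm, ← mul_assoc, hD3, smul_mul_assoc, smul_smul, ← hss,
          ← Complex.ofReal_mul, ← Complex.ofReal_mul]
        have : s⁻¹ * s⁻¹ * (s * s) = 1 := by field_simp
        rw [this, Complex.ofReal_one, one_smul]
  rw [traceDistance, traceNorm, hsq, trace_smul, htrD, smul_eq_mul, ← Complex.ofReal_mul,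
    Complex.ofReal_re, ← hss]
  by_cases h0 : s = 0
  · simp [h0]
  · field_simp

end PureStates

/-! ### Accuracy and number of phase qubits -/

section Estimates

variable {t : ℕ}

theorem phaseEstimate_eq (b : Bits t) : phaseEstimate b = bitsVal b / 2 ^ t := by
  rw [phaseEstimate, bitsVal, eq_div_iff (by positivity), Finset.sum_mul]
  push_cast
  refine Finset.sum_congr rfl fun j _ => ?_
  have h : t = ((j : ℕ) + 1) + (j.rev : ℕ) := by rw [Fin.val_rev]; omega
  have h2 : (2 : ℝ) ^ t = 2 ^ ((j : ℕ) + 1) * 2 ^ (j.rev : ℕ) := by rw [← pow_add, ← h]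
  rw [h2, inv_pow]
  field_simp

/-- An outcome within `8 / 2 ^ t` of the phase, modulo one, gives accurate estimates. -/
theorem abs_estimate_sub_le {ε γ T F : ℝ} (hT : |Real.sin (Real.pi * γ)| = T)
    (hF : |Real.cos (Real.pi * γ)| = F) (hε : 8 * Real.pi ≤ ε * 2 ^ t) (b : Bits t) (m : ℤ)
    (h : |2 ^ t * γ - bitsVal b - m * 2 ^ t| ≤ 8) :
    |traceDistanceEstimate b - T| ≤ ε ∧ |fidelityEstimate b - F| ≤ ε := by
  have hN : (0 : ℝ) < 2 ^ t := by positivity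
  set a := Real.pi * phaseEstimate b with ha
  have hd : |a - (Real.pi * γ - m * Real.pi)| ≤ ε := by
    have e : a - (Real.pi * γ - m * Real.pi) =
        -(Real.pi / 2 ^ t * (2 ^ t * γ - bitsVal b - m * 2 ^ t)) := by
      rw [ha, phaseEstimate_eq]; field_simp; ring
    rw [e, abs_neg, abs_mul, abs_of_pos (by positivity)]
    calc Real.pi / 2 ^ t * |2 ^ t * γ - bitsVal b - m * 2 ^ t| ≤ Real.pi / 2 ^ t * 8 := by gcongr
      _ ≤ ε := by rw [div_mul_eq_mul_div, div_le_iff₀ hN]; linarith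
  have e1 : traceDistanceEstimate b = |Real.sin a| := by
    rw [traceDistanceEstimate, Real.cos_sub_pi_div_two]
  have e2 : fidelityEstimate b = |Real.cos a| := by
    rw [fidelityEstimate, Real.sin_sub_pi_div_two, abs_neg]
  have e3 : T = |Real.sin (Real.pi * γ - m * Real.pi)| := by
    rw [← hT, Real.sin_sub_int_mul_pi, abs_mul, abs_zpow, abs_neg, abs_one,
      _root_.one_zpow, one_mul]
  have e4 : F = |Real.cos (Real.pi * γ - m * Real.pi)| := by
    rw [← hF, Real.cos_sub_int_mul_pi, abs_mul, abs_zpow, abs_neg, abs_one,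
      _root_.one_zpow, one_mul]
  rw [e1, e2, e3, e4]
  have hs := Real.lipschitzWith_sin.dist_le_mul a (Real.pi * γ - m * Real.pi)
  have hc := Real.lipschitzWith_cos.dist_le_mul a (Real.pi * γ - m * Real.pi)
  rw [Real.dist_eq, Real.dist_eq, NNReal.coe_one, one_mul] at hs hc
  exact ⟨(abs_abs_sub_abs_le_abs_sub _ _).trans (hs.trans hd),
    (abs_abs_sub_abs_le_abs_sub _ _).trans (hc.trans hd)⟩

theorem phaseBits_eq (ε : ℝ) :
    phaseBits (1 / 10) (ε / Real.pi) = ⌈Real.logb 2 (Real.pi / ε)⌉₊ + 3 := by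
  have h7 : ⌈Real.logb 2 (2 + 1 / (2 * (1 / 10)))⌉₊ = 3 := by
    rw [show (2 + 1 / (2 * (1 / 10)) : ℝ) = 7 by norm_num, Nat.ceil_eq_iff (by norm_num)]
    constructor
    · rw [Real.lt_logb_iff_rpow_lt (by norm_num) (by norm_num)]; norm_num
    · rw [Real.logb_le_iff_le_rpow (by norm_num) (by norm_num)]; norm_num
  rw [phaseBits, h7, one_div_div]

theorem eight_pi_le {ε : ℝ} (hε : 0 < ε) :
    8 * Real.pi ≤ ε * 2 ^ phaseBits (1 / 10) (ε / Real.pi) := by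
  have h1 : Real.pi / ε ≤ 2 ^ ⌈Real.logb 2 (Real.pi / ε)⌉₊ := by
    rw [← Real.rpow_natCast, ← Real.logb_le_iff_le_rpow (by norm_num) (by positivity)]
    exact Nat.le_ceil _
  rw [div_le_iff₀ hε] at h1
  rw [phaseBits_eq, pow_add]
  linarith

theorem two_pow_phaseBits_le {ε : ℝ} (hε : 0 < ε) (hε1 : ε < 1) :
    2 ^ phaseBits (1 / 10) (ε / Real.pi) ≤ 16 * Real.pi / ε := by
  have hpi : 1 ≤ Real.pi / ε := by
    rw [one_le_div hε]; linarith [Real.pi_gt_three]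
  have h1 : (2 : ℝ) ^ ⌈Real.logb 2 (Real.pi / ε)⌉₊ ≤ 2 * (Real.pi / ε) := by
    have h2 := (Nat.ceil_lt_add_one (Real.logb_nonneg (b := 2) (by norm_num) hpi)).le
    calc (2 : ℝ) ^ ⌈Real.logb 2 (Real.pi / ε)⌉₊ =
          (2 : ℝ) ^ ((⌈Real.logb 2 (Real.pi / ε)⌉₊ : ℕ) : ℝ) := (Real.rpow_natCast _ _).symm
      _ ≤ (2 : ℝ) ^ (Real.logb 2 (Real.pi / ε) + 1) :=
          Real.rpow_le_rpow_of_exponent_le (by norm_num) h2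
      _ = 2 * (Real.pi / ε) := by
          rw [Real.rpow_add (by norm_num), Real.rpow_logb (by norm_num) (by norm_num)
            (by positivity), Real.rpow_one]
          ring
  rw [phaseBits_eq, pow_add]
  calc (2 : ℝ) ^ ⌈Real.logb 2 (Real.pi / ε)⌉₊ * 2 ^ 3 ≤ 2 * (Real.pi / ε) * 2 ^ 3 := by gcongr
    _ = 16 * Real.pi / ε := by ring

theorem phaseBits_isTheta : Asymptotics.IsTheta (nhdsWithin 0 (Set.Ioi 0))
    (fun ε : ℝ => (phaseBits (1 / 10) (ε / Real.pi) : ℝ)) (fun ε : ℝ => Real.log (1 / ε)) := by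
  have hev : ∀ᶠ ε : ℝ in nhdsWithin 0 (Set.Ioi 0), ε ∈ Set.Ioo (0 : ℝ) (Real.exp (-1)) :=
    Ioo_mem_nhdsGT (Real.exp_pos _)
  have hlog2 : 0 < Real.log 2 := Real.log_pos (by norm_num)
  have key : ∀ ε ∈ Set.Ioo (0 : ℝ) (Real.exp (-1)), 1 ≤ Real.log (1 / ε) ∧
      Real.logb 2 (Real.pi / ε) * Real.log 2 = Real.log Real.pi + Real.log (1 / ε) := by
    intro ε hε
    have h1 : Real.log ε < -1 := (Real.log_lt_iff_lt_exp hε.1).mpr hε.2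
    have h2 : Real.log (1 / ε) = -Real.log ε := by rw [one_div, Real.log_inv]
    refine ⟨by linarith, ?_⟩
    rw [Real.logb, div_mul_cancel₀ _ hlog2.ne', Real.log_div Real.pi_ne_zero hε.1.ne', h2]
    ring
  have hpi0 : 0 ≤ Real.log Real.pi := Real.log_nonneg (by linarith [Real.pi_gt_three])
  have hpi3 : Real.log Real.pi ≤ 3 := by
    linarith [Real.log_le_sub_one_of_pos Real.pi_pos, Real.pi_lt_d2]
  have hl := Real.log_two_gt_d9
  have hl' := Real.log_two_lt_d9
  refine ⟨Asymptotics.IsBigO.of_bound 12 ?_, Asymptotics.IsBigO.of_bound 1 ?_⟩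
  · filter_upwards [hev] with ε hε
    obtain ⟨h1, h2⟩ := key ε hε
    have h0 : 0 ≤ Real.logb 2 (Real.pi / ε) := by nlinarith
    have h3 := Nat.ceil_lt_add_one h0
    rw [Real.norm_of_nonneg (by positivity), Real.norm_of_nonneg (by linarith), phaseBits_eq]
    push_cast
    nlinarith
  · filter_upwards [hev] with ε hε
    obtain ⟨h1, h2⟩ := key ε hε
    have h0 : 0 ≤ Real.logb 2 (Real.pi / ε) := by nlinarith
    have h3 := Nat.le_ceil (Real.logb 2 (Real.pi / ε))
    rw [Real.norm_of_nonneg (by positivity), Real.norm_of_nonneg (by linarith), phaseBits_eq]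
    push_cast
    nlinarith

end Estimates

/-! ### Sample complexity -/

section SampleComplexity

theorem samples_le (H : Type) [Fintype H] [DecidableEq H] {ε : ℝ} (hε : ε ∈ Set.Ioo (0 : ℝ) 1) :
    (((samplizedQPE (reflectionSamplizer H 2) ε).samples 0 +
      (samplizedQPE (reflectionSamplizer H 2) ε).samples 1 + 1 : ℕ) : ℝ) ≤
      (3200 * (32 * Real.pi) ^ 2 + 3) / ε ^ 2 := by
  obtain ⟨h0, h1⟩ := hε
  set t := phaseBits (1 / 10) (ε / Real.pi) with ht
  have hs : ∀ j, (samplizedQPE (reflectionSamplizer H 2) ε).samples j =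
      copies (queryCount (phaseEstimation H t)) (1 / 10) := fun _ => rfl
  rw [hs, hs]
  have hQ : (queryCount (phaseEstimation H t) : ℝ) ≤ 32 * Real.pi / ε := by
    have h2 : (queryCount (phaseEstimation H t) : ℝ) ≤ 2 * 2 ^ t := by
      exact_mod_cast queryCount_phaseEstimation H t
    have h3 := two_pow_phaseBits_le h0 h1
    calc _ ≤ _ := h2
      _ ≤ 2 * (16 * Real.pi / ε) := by rw [ht]; gcongr
      _ = 32 * Real.pi / ε := by ring
  have hc : (copies (queryCount (phaseEstimation H t)) (1 / 10) : ℝ) ≤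
      1600 * (32 * Real.pi / ε) ^ 2 + 1 := by
    have h2 := (Nat.ceil_lt_add_one (a := 16 * (queryCount (phaseEstimation H t) : ℝ) ^ 2 /
      (1 / 10) ^ 2) (by positivity)).le
    refine h2.trans ?_
    have h3 : (queryCount (phaseEstimation H t) : ℝ) ^ 2 ≤ (32 * Real.pi / ε) ^ 2 := by gcongr
    have h4 : 16 * (queryCount (phaseEstimation H t) : ℝ) ^ 2 / (1 / 10) ^ 2 =
        1600 * (queryCount (phaseEstimation H t) : ℝ) ^ 2 := by ring
    rw [h4]
    linarith
  push_cast
  have h5 : 3 ≤ 3 / ε ^ 2 := by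
    rw [le_div_iff₀ (by positivity)]
    nlinarith
  have h6 : (3200 * (32 * Real.pi) ^ 2 + 3) / ε ^ 2 =
      3200 * (32 * Real.pi / ε) ^ 2 + 3 / ε ^ 2 := by
    field_simp
  rw [h6]
  linarith

end SampleComplexity

/-! ### Success probability -/

section Success

variable {H : Type} [Fintype H] [DecidableEq H] {t : ℕ}

theorem sum_outcomeProb (ρ : Matrix (Bits t × H) (Bits t × H) ℂ) (G : Finset (Bits t)) :
    ∑ b ∈ G, outcomeProb ρ b = (condProj H (fun b => decide (b ∈ G)) * ρ).trace.re := by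
  simp only [outcomeProb, condProj, Matrix.trace, diag_apply, diagonal_mul, Fintype.sum_prod_type,
    decide_eq_true_eq, ite_mul, one_mul, zero_mul]
  rw [← Complex.re_sum]
  refine congrArg Complex.re ((Finset.sum_congr rfl fun b hb => ?_).trans
    (Finset.sum_subset (Finset.subset_univ G) fun b _ hb => ?_))
  · simp [hb]
  · simp [hb]

theorem outcomeProb_pureDensity (v : EuclideanSpace ℂ (Bits t × H)) (b : Bits t) :
    outcomeProb (pureDensity v) b = ∑ x, ‖v (b, x)‖ ^ 2 := by
  rw [outcomeProb, Complex.re_sum]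
  refine Finset.sum_congr rfl fun x _ => ?_
  rw [pureDensity, of_apply, RCLike.star_def, Complex.mul_conj, Complex.normSq_eq_norm_sq,
    Complex.ofReal_re]

theorem conjChannel_pureDensity {A : Type} [Fintype A] [DecidableEq A] (M : Matrix A A ℂ)
    (v : EuclideanSpace ℂ A) :
    conjChannel M (pureDensity v) = pureDensity (WithLp.toLp 2 (M *ᵥ v.ofLp)) := by
  change M * pureDensity v * Mᴴ = _
  rw [pureDensity_eq_vecMulVec, pureDensity_eq_vecMulVec, mul_vecMulVec, vecMulVec_mul,
    star_mulVec]

/-- The vector `|0⟩ ⊗ φ`. -/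
def inputVector (t : ℕ) (φ : EuclideanSpace ℂ H) : EuclideanSpace ℂ (Bits t × H) :=
  WithLp.toLp 2 fun p => if p.1 = 0 then φ p.2 else 0

theorem inputState_eq (t : ℕ) (φ : EuclideanSpace ℂ H) :
    inputState t φ = pureDensity (inputVector t φ) := by
  ext ⟨b, x⟩ ⟨b', x'⟩
  simp only [inputState, kroneckerMap_apply, single_apply, pureDensity, of_apply, inputVector]
  by_cases h : b = 0 <;> by_cases h' : b' = 0 <;> simp [h, h', eq_comm]

theorem norm_inputVector (t : ℕ) {φ : EuclideanSpace ℂ H} (h : ‖φ‖ = 1) :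
    ‖inputVector t φ‖ = 1 := by
  rw [EuclideanSpace.norm_eq] at h ⊢
  rw [← h, Fintype.sum_prod_type, Finset.sum_eq_single 0]
  · simp [inputVector]
  · intro b _ hb
    simp [inputVector, hb]
  · simp

theorem sum_norm_sq_add_of_orthogonal {u v : H → ℂ} (h : star u ⬝ᵥ v = 0) (α β : ℂ) :
    ∑ x, ‖α * u x + β * v x‖ ^ 2 = ‖α‖ ^ 2 * ∑ x, ‖u x‖ ^ 2 + ‖β‖ ^ 2 * ∑ x, ‖v x‖ ^ 2 := by
  have h1 : inner ℂ (α • (WithLp.toLp 2 u : EuclideanSpace ℂ H)) (β • WithLp.toLp 2 v) = 0 := by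
    rw [inner_smul_left, inner_smul_right, EuclideanSpace.inner_toLp_toLp, dotProduct_comm, h]
    simp
  have h2 := norm_add_sq_eq_norm_sq_add_norm_sq_of_inner_eq_zero _ _ h1
  rw [← sq, ← sq, ← sq, norm_smul, norm_smul, mul_pow, mul_pow, EuclideanSpace.norm_sq_eq,
    EuclideanSpace.norm_sq_eq, EuclideanSpace.norm_sq_eq] at h2
  simpa using h2

theorem bitsVal_injective : Function.Injective (bitsVal : Bits t → ℕ) := fun a b h =>
  (bitsEquiv t).injective (Fin.ext (by rw [bitsEquiv_val, bitsEquiv_val, h]))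

theorem sum_norm_phaseAmp_bitsVal_sq_le (γ : ℝ) (B : Finset (Bits t))
    (hfar : ∀ b ∈ B, ∀ m : ℤ, 8 < |2 ^ t * γ - bitsVal b - m * 2 ^ t|) :
    ∑ b ∈ B, ‖phaseAmp t γ (bitsVal b)‖ ^ 2 ≤ 1 / 14 := by
  rw [← Finset.sum_image (f := fun k => ‖phaseAmp t γ k‖ ^ 2) (g := bitsVal)
    bitsVal_injective.injOn]
  refine sum_norm_phaseAmp_sq_le t γ _ (fun k hk => ?_) fun k hk m => ?_
  · obtain ⟨b, -, rfl⟩ := Finset.mem_image.mp hk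
    rw [← bitsEquiv_val]
    exact (bitsEquiv t b).isLt
  · obtain ⟨b, hb, rfl⟩ := Finset.mem_image.mp hk
    exact hfar b hb m

/-- With the reflections themselves as oracles, phase estimation succeeds with probability at least
`13 / 14`. -/
theorem idealSuccess {φ ψ : EuclideanSpace ℂ H} (hφ : ‖φ‖ = 1) (hψ : ‖ψ‖ = 1) {ε : ℝ}
    (hε : 8 * Real.pi ≤ ε * 2 ^ t) (G : Finset (Bits t))
    (hG : ∀ b ∉ G,
      ¬ (|traceDistanceEstimate b - traceDistance (pureDensity φ) (pureDensity ψ)| ≤ ε ∧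
        |fidelityEstimate b - fidelity (pureDensity φ) (pureDensity ψ)| ≤ ε)) :
    13 / 14 ≤ ∑ b ∈ G, outcomeProb (conjChannel
      (evalCircuit (fun j => reflection (![φ, ψ] j)) (phaseEstimation H t))
        (inputState t φ)) b := by
  have hunit : ∀ j, ‖![φ, ψ] j‖ = 1 := by
    intro j; fin_cases j <;> simp [hφ, hψ]
  set U : Fin 2 → Matrix H H ℂ := fun j => reflection (![φ, ψ] j) with hU
  have hUU : U 0 * U 1 = reflection φ * reflection ψ := rfl
  set M := evalCircuit U (phaseEstimation H t) with hM
  rw [inputState_eq, conjChannel_pureDensity]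
  set F := ‖star ψ.ofLp ⬝ᵥ φ.ofLp‖ with hF
  have hT := traceDistance_pureDensity hφ hψ
  have hFid : fidelity (pureDensity φ) (pureDensity ψ) = F := fidelity_pureDensity hψ
  rw [← hF] at hT
  have hF1 : F ≤ 1 := by
    have := norm_inner_le_norm (𝕜 := ℂ) ψ φ
    rw [hφ, hψ, one_mul, EuclideanSpace.inner_eq_star_dotProduct, dotProduct_comm] at this
    exact this
  set θ := Real.arccos F with hθ
  have hcos : Real.cos θ = F :=
    Real.cos_arccos (by linarith [norm_nonneg (star ψ.ofLp ⬝ᵥ φ.ofLp)]) hF1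
  have hsin : Real.sin θ = Real.sqrt (1 - F ^ 2) := Real.sin_arccos F
  obtain ⟨u, v, huv, hu, hv, horth⟩ := exists_eigenvectors hφ hψ (hcos.trans hF)
  rw [← hUU] at hu hv
  have hpi := Real.pi_ne_zero
  have hpiC : (Real.pi : ℂ) ≠ 0 := Complex.ofReal_ne_zero.mpr hpi
  have hu' : (U 0 * U 1) *ᵥ u = Complex.exp (2 * Real.pi * I * (θ / Real.pi : ℝ)) • u := by
    rw [hu]; congr 2; push_cast; field_simp
  have hv' : (U 0 * U 1) *ᵥ v = Complex.exp (2 * Real.pi * I * (-θ / Real.pi : ℝ)) • v := by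
    rw [hv]; congr 2; push_cast; field_simp
  have hamp : ∀ b x, (M *ᵥ (inputVector t φ).ofLp) (b, x) =
      phaseAmp t (θ / Real.pi) (bitsVal b) * u x + phaseAmp t (-θ / Real.pi) (bitsVal b) * v x := by
    intro b x
    rw [← phaseEstimation_mulVec_eigenvector U hu', ← phaseEstimation_mulVec_eigenvector U hv',
      ← Pi.add_apply, ← mulVec_add]
    have h1 : (inputVector t φ).ofLp = (fun p => if p.1 = 0 then u p.2 else 0) +
        fun p => if p.1 = 0 then v p.2 else 0 := by
      funext p
      simp only [inputVector, huv, Pi.add_apply]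
      split_ifs <;> simp
    rw [h1]
  have hprob : ∀ b, outcomeProb (pureDensity (WithLp.toLp 2 (M *ᵥ (inputVector t φ).ofLp))) b =
      ‖phaseAmp t (θ / Real.pi) (bitsVal b)‖ ^ 2 * ∑ x, ‖u x‖ ^ 2 +
        ‖phaseAmp t (-θ / Real.pi) (bitsVal b)‖ ^ 2 * ∑ x, ‖v x‖ ^ 2 := by
    intro b
    rw [outcomeProb_pureDensity, ← sum_norm_sq_add_of_orthogonal horth]
    exact Finset.sum_congr rfl fun x _ => by rw [← hamp]
  have huvnorm : ∑ x, ‖u x‖ ^ 2 + ∑ x, ‖v x‖ ^ 2 = 1 := by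
    have h1 := sum_norm_sq_add_of_orthogonal horth 1 1
    have h2 := EuclideanSpace.norm_sq_eq φ
    rw [hφ, huv] at h2
    simp only [one_mul, norm_one, one_pow, Pi.add_apply] at h1 h2
    rw [← h1, ← h2]
  have htotal : ∑ b, outcomeProb (pureDensity (WithLp.toLp 2 (M *ᵥ (inputVector t φ).ofLp))) b =
      1 := by
    have hMu : Mᴴ * M = 1 := mem_unitaryGroup_iff'.mp (evalCircuit_mem_unitaryGroup hunit _)
    have h1 : ∑ b, outcomeProb (pureDensity (WithLp.toLp 2 (M *ᵥ (inputVector t φ).ofLp))) b =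
        (conjChannel M (pureDensity (inputVector t φ))).trace.re := by
      rw [conjChannel_pureDensity, Matrix.trace, Fintype.sum_prod_type, Complex.re_sum]
      rfl
    have h2 : (conjChannel M (pureDensity (inputVector t φ))).trace = 1 := by
      change (M * pureDensity (inputVector t φ) * Mᴴ).trace = 1
      rw [trace_mul_comm, ← mul_assoc, hMu, one_mul, trace_pureDensity (norm_inputVector t hφ)]
    rw [h1, h2, Complex.one_re]
  have hfar : ∀ γ, |Real.sin (Real.pi * γ)| = Real.sqrt (1 - F ^ 2) → |Real.cos (Real.pi * γ)| = F →
      ∑ b ∈ Gᶜ, ‖phaseAmp t γ (bitsVal b)‖ ^ 2 ≤ 1 / 14 := by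
    intro γ h1 h2
    refine sum_norm_phaseAmp_bitsVal_sq_le γ _ fun b hb m => ?_
    by_contra hcon
    refine hG b (Finset.mem_compl.mp hb) ?_
    rw [hT, hFid]
    exact abs_estimate_sub_le h1 h2 hε b m (not_lt.mp hcon)
  have h1 := hfar (θ / Real.pi) (by
      rw [mul_div_cancel₀ _ hpi, hsin, abs_of_nonneg (Real.sqrt_nonneg _)])
    (by rw [mul_div_cancel₀ _ hpi, hcos, abs_of_nonneg (norm_nonneg _)])
  have h2 := hfar (-θ / Real.pi) (by
      rw [mul_div_cancel₀ _ hpi, Real.sin_neg, abs_neg, hsin, abs_of_nonneg (Real.sqrt_nonneg _)])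
    (by rw [mul_div_cancel₀ _ hpi, Real.cos_neg, hcos, abs_of_nonneg (norm_nonneg _)])
  have hbad : ∑ b ∈ Gᶜ, outcomeProb
      (pureDensity (WithLp.toLp 2 (M *ᵥ (inputVector t φ).ofLp))) b ≤ 1 / 14 := by
    simp only [hprob]
    rw [Finset.sum_add_distrib, ← Finset.sum_mul, ← Finset.sum_mul]
    have h3 : 0 ≤ ∑ x, ‖u x‖ ^ 2 := by positivity
    have h4 : 0 ≤ ∑ x, ‖v x‖ ^ 2 := by positivity
    nlinarith
  have := Finset.sum_add_sum_compl G fun b =>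
    outcomeProb (pureDensity (WithLp.toLp 2 (M *ᵥ (inputVector t φ).ofLp))) b
  linarith

theorem successProb_ge (𝒮 : Samplizer H 2) {φ ψ : EuclideanSpace ℂ H} (hφ : ‖φ‖ = 1)
    (hψ : ‖ψ‖ = 1) {ε : ℝ} (hε : 0 < ε) : 2 / 3 ≤ successProb 𝒮 ε φ ψ := by
  classical
  have hunit : ∀ j, ‖![φ, ψ] j‖ = 1 := by
    intro j; fin_cases j <;> simp [hφ, hψ]
  have hspec := 𝒮.spec (1 / 10) (by norm_num) _ (QPE H (1 / 10) (ε / Real.pi)) ![φ, ψ] hunit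
  rw [successProb]
  set G := Finset.univ.filter fun b : Bits (phaseBits (1 / 10) (ε / Real.pi)) =>
    |traceDistanceEstimate b - traceDistance (pureDensity φ) (pureDensity ψ)| ≤ ε ∧
      |fidelityEstimate b - fidelity (pureDensity φ) (pureDensity ψ)| ≤ ε with hG
  have hideal := idealSuccess hφ hψ (eight_pi_le hε) G fun b hb hcon =>
    hb (Finset.mem_filter.mpr ⟨Finset.mem_univ b, hcon⟩)
  have hE : ‖condProj H fun b => decide (b ∈ G)‖ ≤ 1 :=
    norm_le_one_of_projection (conjTranspose_condProj _) (condProj_mul_self _)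
  have hdiff := norm_trace_mul_le_of_diamondNorm_le (by norm_num) hspec hE
    (norm_inputVector _ hφ)
  rw [← inputState_eq, LinearMap.sub_apply, mul_sub, trace_sub] at hdiff
  rw [sum_outcomeProb] at hideal ⊢
  have h1 := (Complex.abs_re_le_norm _).trans hdiff
  rw [Complex.sub_re] at h1
  have h2 := (abs_le.mp h1).1
  change 2 / 3 ≤ (condProj H (fun b => decide (b ∈ G)) *
    (𝒮.conv (1 / 10) _ (QPE H (1 / 10) (ε / Real.pi))).run ![φ, ψ] (inputState _ φ)).trace.re
  change 13 / 14 ≤ (condProj H (fun b => decide (b ∈ G)) * conjChannel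
    (evalCircuit (fun j => reflection (![φ, ψ] j)) (QPE H (1 / 10) (ε / Real.pi)))
      (inputState _ φ)).trace.re at hideal
  linarith

end Success

end PureStateEstimation

end

theorem theorem6p1 :
    Asymptotics.IsTheta (nhdsWithin 0 (Set.Ioi 0))
      (fun ε : ℝ => (phaseBits (1 / 10) (ε / Real.pi) : ℝ)) (fun ε : ℝ => Real.log (1 / ε)) ∧
    (∀ (H : Type) [Fintype H] [DecidableEq H] (𝒮 : Samplizer H 2) (φ ψ : EuclideanSpace ℂ H),
      ‖φ‖ = 1 → ‖ψ‖ = 1 → ∀ ε ∈ Set.Ioo (0 : ℝ) 1, 2 / 3 ≤ successProb 𝒮 ε φ ψ) ∧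
    (∃ C : ℝ, 0 < C ∧ ∀ (H : Type) [Fintype H] [DecidableEq H], ∃ 𝒮 : Samplizer H 2,
      ∀ ε ∈ Set.Ioo (0 : ℝ) 1,
        (((samplizedQPE 𝒮 ε).samples 0 + (samplizedQPE 𝒮 ε).samples 1 + 1 : ℕ) : ℝ)
          ≤ C / ε ^ 2) := by
  refine ⟨phaseBits_isTheta, fun H _ _ 𝒮 φ ψ hφ hψ ε hε => successProb_ge 𝒮 hφ hψ hε.1,
    3200 * (32 * Real.pi) ^ 2 + 3, by positivity, fun H _ _ => ?_⟩
  exact ⟨reflectionSamplizer H 2, fun ε hε => samples_le H hε⟩
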